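/- Let $M$ be a smooth manifold and let $\mathbb{E}\to M$ be a Courant algebroid with anchor $\mathbf{a}\colon\mathbb{E}\to TM$, bundle metric $\langle\cdot,\cdot\rangle$ (a nondegenerate symmetric bilinear form on the fibres) and bracket $[\![\cdot,\cdot]\!]$ on $\Gamma(\mathbb{E})$, satisfying $[\![\sigma_1,[\![\sigma_2,\sigma_3]\!]]\!]=[\![[\![\sigma_1,\sigma_2]\!],\sigma_3]\!]+[\![\sigma_2,[\![\sigma_1,\sigma_3]\!]]\!]$, $\mathbf{a}(\sigma_1)\langle\sigma_2,\sigma_3\rangle=\langle[\![\sigma_1,\sigma_2]\!],\sigma_3\rangle+\langle\sigma_2,[\![\sigma_1,\sigma_3]\!]\rangle$ and $[\![\sigma_1,\sigma_2]\!]+[\![\sigma_2,\sigma_1]\!]=\mathbf{a}^*d\langle\sigma_1,\sigma_2\rangle$. Here, for $\theta\in T^*_xM$, $\mathbf{a}^*\theta\in\mathbb{E}_x$ is the element with $\langle\mathbf{a}^*\theta,u\rangle=\theta(\mathbf{a}(u))$ for all $u\in\mathbb{E}_x$. The total space $T\mathbb{E}$ of the tangent bundle of the manifold $\mathbb{E}$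 is a vector bundle over $\mathbb{E}$ and, with the tangent maps of the structure maps of $\mathbb{E}\to M$, a vector bundle over $TM$. A section $\sigma\in\Gamma(\mathbb{E})$ has a tangent lift $\sigma_T=d\sigma\in\Gamma(T\mathbb{E},TM)$ and a core section $\sigma_C\in\Gamma(T\mathbb{E},TM)$, where $\sigma_C(v)$, for $v\in T_xM$, is the sum in $T_{0_x}\mathbb{E}$ of the image of $v$ under the zero section and of the vertical vector defined by $\sigma(x)$. Equip $T\mathbb{E}\to TM$ with its tangent prolongation Courant algebroid structure: the pairing is the tangent map of the pairing of $\mathbb{E}$, the anchor is $d\mathbf{a}$ followed by the canonical flip of $T(TM)$, and the bracket is determined by $$[\![\sigma_T,\tau_T]\!]=[\![\sigma,\tau]\!]_T,\quad [\![\sigma_T,\tau_C]\!]=[\![\sigma_C,\tau_T]\!]=[\![\sigma,\tau]\!]_C,\quad [\![\sigma_C,\tau_C]\!]=0$$ and the Leibniz rules $[\![s,ft]\!]=f[\![s,t]\!]+(\mathbf{a}(s)f)\,t$ and $[\![fs,t]\!]=f[\![s,t]\!]-(\mathbf{a}(t)f)\,s+\langle s,t\rangle\,\mathbf{a}^*df$.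 Let $W\subseteq\mathbb{E}$ be a smooth vector subbundle over $M$ and let $L\subseteq T\mathbb{E}$ be a $\mathcal{VB}$-Dirac structure with side bundles $W$ and $TM$. That is, $L$ is a vector subbundle of $T\mathbb{E}\to TM$ over all of $TM$ and a vector subbundle of $T\mathbb{E}|_W\to W$, it is Lagrangian ($L^\perp=L$) over $TM$, and $\Gamma(L,TM)$ is closed under the Courant bracket, so that $L\to TM$ is a Lie algebroid with the restricted bracket and anchor. Let $q_L\colon T\mathbb{E}|_W\to\mathbb{E}/W^\perp\cong W^*$ be the quotient map by $L$: if $p\in T\mathbb{E}|_W$ over $v\in T_xM$ differs, in the fibre of $T\mathbb{E}\to TM$ over $v$, from an element of $L$ by the core element defined by $c\in\mathbb{E}_x$, then $q_L(p)=\langle c,\cdot\rangle|_{W_x}$. Let $\nabla\colon\Gamma(W)\to\Gamma(T^*M\otimes W^*)$, $\nabla\sigma=q_L\circ\sigma_T$, be the associated pseudo-connection. The bundle $W$ inherits from $L\to TM$ the bracket $[\cdot,\cdot]$ for which the projection $q\colon L\to W$, the restriction of $T\mathbb{E}\to\mathbb{E}$, is a morphism of Lie algebroids: for $\sigma,\tau\in\Gamma(W)$,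 $[\sigma,\tau]\in\Gamma(W)$ is the section such that $[\![s,t]\!]$ is $q$-related to $[\sigma,\tau]$ for all $s,t\in\Gamma(L,TM)$ which are $q$-related to $\sigma$ and $\tau$ (such $s,t$ exist). Then, for all $\sigma,\tau\in\Gamma(W)$, $$[\sigma,\tau]=[\![\sigma,\tau]\!]-\mathbf{a}^*\langle\nabla\sigma,\tau\rangle .$$ More precisely, the right-hand side is a smooth section of $W$ which is the inherited bracket of $\sigma$ and $\tau$ in this sense; and the bracket of every Lie algebroid structure on $W$ for which $q\colon L\to W$ is a morphism of Lie algebroids is given by this formula. -/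

import Mathlib

open Bundle Set Filter Topology Manifold ContDiff

set_option linter.unusedSectionVars false

noncomputable section

namespace VBDirac

/-! Throughout, `M` is a smooth manifold modelled on the finite-dimensional vector space `E`, and
`V` is (the family of fibres of) a smooth vector bundle `𝔼 → M` with model fibre `F`; its total
space is the manifold `TotalSpace F V`. -/

section Charts

/-! Tangent maps of fibrewise maps, in the preferred charts. -/

variable {E : Type*} [NormedAddCommGroup E] [NormedSpace ℝ E]
  {M : Type*} [TopologicalSpace M] [ChartedSpace E M]
  {F : Type*} [NormedAddCommGroup F] [NormedSpace ℝ F]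
  {V : M → Type*} [∀ x, TopologicalSpace (V x)]
  [TopologicalSpace (TotalSpace F V)] [FiberBundle F V]
  {F' : Type*} [NormedAddCommGroup F'] [NormedSpace ℝ F']
  {V' : M → Type*} [∀ x, TopologicalSpace (V' x)]
  [TopologicalSpace (TotalSpace F' V')] [FiberBundle F' V']

theorem extChartAt_symm_aux (e : TotalSpace F V) (z : E × F)
    (hz : z ∈ (extChartAt (𝓘(ℝ, E).prod 𝓘(ℝ, F)) e).target) :
    (((extChartAt (𝓘(ℝ, E).prod 𝓘(ℝ, F)) e).symm z).proj ∈ (trivializationAt F V e.proj).baseSet) ∧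
    extChartAt 𝓘(ℝ, E) e.proj ((extChartAt (𝓘(ℝ, E).prod 𝓘(ℝ, F)) e).symm z).proj = z.1 ∧
    (trivializationAt F V e.proj ((extChartAt (𝓘(ℝ, E).prod 𝓘(ℝ, F)) e).symm z)).2 = z.2 := by
  have h1 := (extChartAt (𝓘(ℝ, E).prod 𝓘(ℝ, F)) e).right_inv hz
  have h2 := (extChartAt (𝓘(ℝ, E).prod 𝓘(ℝ, F)) e).map_target hz
  have h3 : ((extChartAt (𝓘(ℝ, E).prod 𝓘(ℝ, F)) e).symm z).proj ∈
      (trivializationAt F V e.proj).baseSet := by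
    rw [extChartAt_source, FiberBundle.chartedSpace_chartAt] at h2
    simp only [mfld_simps] at h2
    exact (Trivialization.mem_source _).1 h2.1
  refine ⟨h3, ?_⟩
  generalize (extChartAt (𝓘(ℝ, E).prod 𝓘(ℝ, F)) e).symm z = y at *
  rw [FiberBundle.extChartAt] at h1
  have h4 : (trivializationAt F V e.proj y).1 = y.proj := by
    rw [Trivialization.coe_fst' _ h3]
  rw [← h1, ← h4]
  simp

theorem hasMFDerivAt_proj (e : TotalSpace F V) :
    HasMFDerivAt (𝓘(ℝ, E).prod 𝓘(ℝ, F)) 𝓘(ℝ, E) (TotalSpace.proj : TotalSpace F V → M) e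
      (ContinuousLinearMap.fst ℝ E F) := by
  refine ⟨(FiberBundle.continuous_proj F V).continuousAt, ?_⟩
  have h : HasFDerivWithinAt (Prod.fst : E × F → E) (ContinuousLinearMap.fst ℝ E F)
      (range (𝓘(ℝ, E).prod 𝓘(ℝ, F)))
      (extChartAt (𝓘(ℝ, E).prod 𝓘(ℝ, F)) e e) := hasFDerivWithinAt_fst
  have key : ∀ z ∈ (extChartAt (𝓘(ℝ, E).prod 𝓘(ℝ, F)) e).target,
      writtenInExtChartAt (𝓘(ℝ, E).prod 𝓘(ℝ, F)) 𝓘(ℝ, E) e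
        (TotalSpace.proj : TotalSpace F V → M) z = z.1 := fun z hz =>
    (extChartAt_symm_aux e z hz).2.1
  refine h.congr_of_eventuallyEq ?_ (key _ (mem_extChartAt_target e))
  filter_upwards [extChartAt_target_mem_nhdsWithin e] with z hz using key z hz

theorem hasMFDerivAt_fibrewise (Φ : ∀ x, V x → V' x) (A : F →L[ℝ] F') (e : TotalSpace F V)
    (hb : (trivializationAt F V e.proj).baseSet ⊆ (trivializationAt F' V' e.proj).baseSet)
    (h : ∀ z : TotalSpace F V, z.proj ∈ (trivializationAt F V e.proj).baseSet →
      (trivializationAt F' V' e.proj ⟨z.proj, Φ z.proj z.2⟩).2 =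
        A (trivializationAt F V e.proj z).2) :
    HasMFDerivAt (𝓘(ℝ, E).prod 𝓘(ℝ, F)) (𝓘(ℝ, E).prod 𝓘(ℝ, F'))
      (fun z : TotalSpace F V => (⟨z.proj, Φ z.proj z.2⟩ : TotalSpace F' V')) e
      ((ContinuousLinearMap.id ℝ E).prodMap A) := by
  have hmem : e.proj ∈ (trivializationAt F V e.proj).baseSet := mem_baseSet_trivializationAt F V _
  refine ⟨?_, ?_⟩
  · rw [FiberBundle.continuousAt_totalSpace]
    refine ⟨(FiberBundle.continuous_proj F V).continuousAt, ?_⟩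
    have hc : ContinuousAt (fun z => A (trivializationAt F V e.proj z).2) e :=
      A.continuous.continuousAt.comp (continuous_snd.continuousAt.comp
        ((trivializationAt F V e.proj).continuousAt
          ((Trivialization.mem_source _).2 hmem)))
    refine hc.congr ?_
    filter_upwards [(FiberBundle.continuous_proj F V).continuousAt.preimage_mem_nhds
      ((trivializationAt F V e.proj).open_baseSet.mem_nhds hmem)] with z hz using (h z hz).symm
  have hA : HasFDerivWithinAt (fun z : E × F => (z.1, A z.2))
      ((ContinuousLinearMap.id ℝ E).prodMap A) (range (𝓘(ℝ, E).prod 𝓘(ℝ, F)))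
      (extChartAt (𝓘(ℝ, E).prod 𝓘(ℝ, F)) e e) :=
    ((ContinuousLinearMap.id ℝ E).prodMap A).hasFDerivWithinAt
  have key : ∀ z ∈ (extChartAt (𝓘(ℝ, E).prod 𝓘(ℝ, F)) e).target,
      writtenInExtChartAt (𝓘(ℝ, E).prod 𝓘(ℝ, F)) (𝓘(ℝ, E).prod 𝓘(ℝ, F')) e
       (fun z : TotalSpace F V => (⟨z.proj, Φ z.proj z.2⟩ : TotalSpace F' V')) z =
        (z.1, A z.2) := by
    intro z hz
    obtain ⟨h1, h2, h3⟩ := extChartAt_symm_aux e z hz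
    have h4 := h _ h1
    rw [h3] at h4
    simp only [writtenInExtChartAt, Function.comp]
    rw [FiberBundle.extChartAt (F := F')]
    simp only [PartialEquiv.trans_apply, PartialEquiv.prod_coe, PartialEquiv.refl_coe, id]
    refine Prod.ext ?_ h4
    simp only
    rw [← h2]
    congr 1
    exact Trivialization.coe_fst' _ (hb h1)
  refine hA.congr_of_eventuallyEq ?_ (key _ (mem_extChartAt_target e))
  filter_upwards [extChartAt_target_mem_nhdsWithin e] with z hz using key z hz

end Charts

section Prolongation

variable {E : Type*} [NormedAddCommGroup E] [NormedSpace ℝ E]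
  {M : Type*} [TopologicalSpace M] [ChartedSpace E M] [IsManifold 𝓘(ℝ, E) ∞ M]
  {F : Type*} [NormedAddCommGroup F] [NormedSpace ℝ F]
  {V : M → Type*} [∀ x, AddCommGroup (V x)] [∀ x, Module ℝ (V x)] [∀ x, TopologicalSpace (V x)]
  [TopologicalSpace (TotalSpace F V)] [FiberBundle F V] [VectorBundle ℝ F V]
  [ContMDiffVectorBundle ∞ F V 𝓘(ℝ, E)]

/-! ### The vector bundle `T𝔼 → TM` -/

/-- The fibre of the vector bundle `T𝔼 → TM` over `v ∈ T_x M`. In Mathlib a vector tangent to the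
total space of `𝔼` at `e ∈ 𝔼_x` is a pair in `E × F`, namely its coordinates in the preferred chart
at `e`. This chart depends on `x` only and is linear on the fibres of `𝔼`, so a vector tangent to
`𝔼` which projects to `v` is the same as a pair `(e, w)` with `e ∈ 𝔼_x` and `w ∈ F` (see `toTE`,
`tangentMap_proj_toTE`, `exists_toTE`), and the vector space structure of the fibre, whose
operations are the tangent maps of the fibrewise operations of `𝔼`, is the componentwise one
(see `tangentMap_add_toTE₂`, `tangentMap_smul_toTE`). -/
abbrev TFib (F : Type*) (V : M → Type*) (v : TangentBundle 𝓘(ℝ, E) M) : Type _ :=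
  V v.proj × F

/-- The inclusion into `T𝔼` of its fibre over `v ∈ TM`. -/
def toTE (v : TangentBundle 𝓘(ℝ, E) M) (p : TFib F V v) :
    TangentBundle (𝓘(ℝ, E).prod 𝓘(ℝ, F)) (TotalSpace F V) :=
  ⟨⟨v.proj, p.1⟩, ((show E from v.2, p.2) : E × F)⟩

/-- The vector tangent to `𝔼 ×_M 𝔼` with components `p` and `q`. -/
def toTE₂ (v : TangentBundle 𝓘(ℝ, E) M) (p q : TFib F V v) :
    TangentBundle (𝓘(ℝ, E).prod 𝓘(ℝ, F × F)) (TotalSpace (F × F) (V ×ᵇ V)) :=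
  ⟨⟨v.proj, (p.1, q.1)⟩, ((show E from v.2, (p.2, q.2)) : E × (F × F))⟩

theorem tangentMap_proj_toTE (v : TangentBundle 𝓘(ℝ, E) M) (p : TFib F V v) :
    tangentMap (𝓘(ℝ, E).prod 𝓘(ℝ, F)) 𝓘(ℝ, E) (TotalSpace.proj : TotalSpace F V → M) (toTE v p) =
      v := by
  have h := (hasMFDerivAt_proj (E := E) (toTE v p).proj).mfderiv
  rw [tangentMap, h]
  rfl

theorem exists_toTE (ξ : TangentBundle (𝓘(ℝ, E).prod 𝓘(ℝ, F)) (TotalSpace F V)) :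
    ∃ (v : TangentBundle 𝓘(ℝ, E) M) (p : TFib F V v), toTE v p = ξ :=
  ⟨⟨ξ.proj.proj, (show E × F from ξ.2).1⟩, (ξ.proj.2, (show E × F from ξ.2).2), rfl⟩

theorem tangentMap_fst_toTE₂ (v : TangentBundle 𝓘(ℝ, E) M) (p q : TFib F V v) :
    tangentMap (𝓘(ℝ, E).prod 𝓘(ℝ, F × F)) (𝓘(ℝ, E).prod 𝓘(ℝ, F))
      (fun z : TotalSpace (F × F) (V ×ᵇ V) => (⟨z.proj, z.2.1⟩ : TotalSpace F V)) (toTE₂ v p q) =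
      toTE v p := by
  have h := (hasMFDerivAt_fibrewise (E := E) (V := V ×ᵇ V) (V' := V) (fun x u => u.1)
    (ContinuousLinearMap.fst ℝ F F) (toTE₂ v p q).proj inter_subset_left
    (fun z hz => rfl)).mfderiv
  rw [tangentMap, h]
  rfl

theorem tangentMap_snd_toTE₂ (v : TangentBundle 𝓘(ℝ, E) M) (p q : TFib F V v) :
    tangentMap (𝓘(ℝ, E).prod 𝓘(ℝ, F × F)) (𝓘(ℝ, E).prod 𝓘(ℝ, F))
      (fun z : TotalSpace (F × F) (V ×ᵇ V) => (⟨z.proj, z.2.2⟩ : TotalSpace F V)) (toTE₂ v p q) =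
      toTE v q := by
  have h := (hasMFDerivAt_fibrewise (E := E) (V := V ×ᵇ V) (V' := V) (fun x u => u.2)
    (ContinuousLinearMap.snd ℝ F F) (toTE₂ v p q).proj inter_subset_left
    (fun z hz => rfl)).mfderiv
  rw [tangentMap, h]
  rfl

theorem tangentMap_add_toTE₂ (v : TangentBundle 𝓘(ℝ, E) M) (p q : TFib F V v) :
    tangentMap (𝓘(ℝ, E).prod 𝓘(ℝ, F × F)) (𝓘(ℝ, E).prod 𝓘(ℝ, F))
      (fun z : TotalSpace (F × F) (V ×ᵇ V) => (⟨z.proj, z.2.1 + z.2.2⟩ : TotalSpace F V))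
      (toTE₂ v p q) = toTE v (p + q) := by
  have h := (hasMFDerivAt_fibrewise (E := E) (V := V ×ᵇ V) (V' := V) (fun x u => u.1 + u.2)
    (ContinuousLinearMap.fst ℝ F F + ContinuousLinearMap.snd ℝ F F) (toTE₂ v p q).proj
    inter_subset_left (fun z hz => by
      have h1 : z.proj ∈ (trivializationAt F V v.proj).baseSet := hz.1
      exact ((trivializationAt F V v.proj).linear ℝ h1).map_add z.2.1 z.2.2)).mfderiv
  rw [tangentMap, h]
  rfl

theorem tangentMap_smul_toTE (v : TangentBundle 𝓘(ℝ, E) M) (c : ℝ) (p : TFib F V v) :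
    tangentMap (𝓘(ℝ, E).prod 𝓘(ℝ, F)) (𝓘(ℝ, E).prod 𝓘(ℝ, F))
      (fun z : TotalSpace F V => (⟨z.proj, c • z.2⟩ : TotalSpace F V)) (toTE v p) =
      toTE v (c • p) := by
  have h := (hasMFDerivAt_fibrewise (E := E) (V := V) (V' := V) (fun x u => c • u)
    (c • ContinuousLinearMap.id ℝ F) (toTE v p).proj (fun x hx => hx) (fun z hz =>
      ((trivializationAt F V v.proj).linear ℝ hz).map_smul c z.2)).mfderiv
  rw [tangentMap, h]
  rfl

/-- `s : TM → T𝔼` is a smooth section of `T𝔼 → TM`. -/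
def IsSmoothSection (s : ∀ v : TangentBundle 𝓘(ℝ, E) M, TFib F V v) : Prop :=
  ContMDiff (𝓘(ℝ, E).prod 𝓘(ℝ, E)) ((𝓘(ℝ, E).prod 𝓘(ℝ, F)).prod 𝓘(ℝ, E × F)) ∞
    (fun v => toTE v (s v))

/-- The tangent lift `σ_T = dσ : TM → T𝔼` of a section `σ` of `𝔼`. -/
def liftT (σ : Cₛ^∞⟮𝓘(ℝ, E); F, V⟯) (v : TangentBundle 𝓘(ℝ, E) M) : TFib F V v :=
  (σ v.proj,
    (show E × F from mfderiv 𝓘(ℝ, E) (𝓘(ℝ, E).prod 𝓘(ℝ, F))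
      (fun x => (⟨x, σ x⟩ : TotalSpace F V)) v.proj v.2).2)

/-- The core element `c ∈ 𝔼_x`, in the fibre of `T𝔼 → TM` over `v ∈ T_x M`. It is the sum, in the
vector space `T_0 𝔼` at the zero `0 ∈ 𝔼_x`, of the image of `v` under the zero section and of the
vector `c` tangent to the fibre `𝔼_x`, which is the velocity of `t ↦ t c` at `t = 0`. -/
def core (v : TangentBundle 𝓘(ℝ, E) M) (c : V v.proj) : TFib F V v :=
  (0, (show E × F from mfderiv 𝓘(ℝ, ℝ) (𝓘(ℝ, E).prod 𝓘(ℝ, F))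
      (fun t : ℝ => (⟨v.proj, t • c⟩ : TotalSpace F V)) (0 : ℝ) (1 : ℝ)).2)

/-- The core section `σ_C` of `T𝔼 → TM` defined by a section `σ` of `𝔼`. -/
def liftC (σ : Cₛ^∞⟮𝓘(ℝ, E); F, V⟯) (v : TangentBundle 𝓘(ℝ, E) M) : TFib F V v :=
  core v (σ v.proj)

end Prolongation

section Courant

/-! ### Courant algebroids -/

/-- A Courant algebroid structure on the vector bundle `𝔼 → M`: a bundle metric (a smooth
nondegenerate symmetric bilinear form on the fibres), an anchor `𝔼 → TM` and a bracket on sections,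
with the axioms (c1), (c2), (c3); the last one is paired with an arbitrary `u ∈ 𝔼`, so that
`⟨a^* d⟨σ, τ⟩, u⟩ = a(u) ⟨σ, τ⟩`. -/
structure CourantAlgebroid (E : Type*) [NormedAddCommGroup E] [NormedSpace ℝ E]
    {M : Type*} [TopologicalSpace M] [ChartedSpace E M] [IsManifold 𝓘(ℝ, E) ∞ M]
    (F : Type*) [NormedAddCommGroup F] [NormedSpace ℝ F]
    (V : M → Type*) [∀ x, AddCommGroup (V x)] [∀ x, Module ℝ (V x)] [∀ x, TopologicalSpace (V x)]
    [TopologicalSpace (TotalSpace F V)] [FiberBundle F V] [VectorBundle ℝ F V] where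
  pairing : ∀ x, V x →ₗ[ℝ] V x →ₗ[ℝ] ℝ
  pairing_smooth : ContMDiff (𝓘(ℝ, E).prod 𝓘(ℝ, F × F)) 𝓘(ℝ, ℝ) ∞
    (fun z : TotalSpace (F × F) (V ×ᵇ V) => pairing z.proj z.2.1 z.2.2)
  pairing_symm : ∀ x u w, pairing x u w = pairing x w u
  pairing_nondeg : ∀ x u, (∀ w, pairing x u w = 0) → u = 0
  anchor : ∀ x, V x →ₗ[ℝ] TangentSpace 𝓘(ℝ, E) x
  anchor_smooth : ContMDiff (𝓘(ℝ, E).prod 𝓘(ℝ, F)) (𝓘(ℝ, E).prod 𝓘(ℝ, E)) ∞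
    (fun e : TotalSpace F V => (⟨e.proj, anchor e.proj e.2⟩ : TangentBundle 𝓘(ℝ, E) M))
  bracket : Cₛ^∞⟮𝓘(ℝ, E); F, V⟯ →ₗ[ℝ] Cₛ^∞⟮𝓘(ℝ, E); F, V⟯ →ₗ[ℝ] Cₛ^∞⟮𝓘(ℝ, E); F, V⟯
  jacobi : ∀ σ₁ σ₂ σ₃, bracket σ₁ (bracket σ₂ σ₃) =
    bracket (bracket σ₁ σ₂) σ₃ + bracket σ₂ (bracket σ₁ σ₃)
  anchor_pairing : ∀ σ₁ σ₂ σ₃ x,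
    mfderiv 𝓘(ℝ, E) 𝓘(ℝ, ℝ) (fun y => pairing y (σ₂ y) (σ₃ y)) x (anchor x (σ₁ x)) =
      pairing x (bracket σ₁ σ₂ x) (σ₃ x) + pairing x (σ₂ x) (bracket σ₁ σ₃ x)
  bracket_add_swap : ∀ σ₁ σ₂ x (u : V x),
    pairing x (bracket σ₁ σ₂ x + bracket σ₂ σ₁ x) u =
      mfderiv 𝓘(ℝ, E) 𝓘(ℝ, ℝ) (fun y => pairing y (σ₁ y) (σ₂ y)) x (anchor x u)

variable {E : Type*} [NormedAddCommGroup E] [NormedSpace ℝ E]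
  {M : Type*} [TopologicalSpace M] [ChartedSpace E M] [IsManifold 𝓘(ℝ, E) ∞ M]
  {F : Type*} [NormedAddCommGroup F] [NormedSpace ℝ F]
  {V : M → Type*} [∀ x, AddCommGroup (V x)] [∀ x, Module ℝ (V x)] [∀ x, TopologicalSpace (V x)]
  [TopologicalSpace (TotalSpace F V)] [FiberBundle F V] [VectorBundle ℝ F V]
  [ContMDiffVectorBundle ∞ F V 𝓘(ℝ, E)]

/-- `a^* θ ∈ 𝔼_x` for a covector `θ` at `x`: the element with `⟨a^* θ, u⟩ = θ (a u)` for all `u`. -/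
def CourantAlgebroid.coanchor (C : CourantAlgebroid E F V) (x : M)
    (θ : TangentSpace 𝓘(ℝ, E) x → ℝ) : V x :=
  Classical.epsilon fun b => ∀ u, C.pairing x b u = θ (C.anchor x u)

/-! ### The tangent prolongation `T𝔼 → TM` of a Courant algebroid -/

/-- The pairing on the fibres of `T𝔼 → TM`: the tangent map of the pairing `𝔼 ×_M 𝔼 → ℝ`. -/
def pairingT (C : CourantAlgebroid E F V) (v : TangentBundle 𝓘(ℝ, E) M) (p q : TFib F V v) : ℝ :=
  mfderiv (𝓘(ℝ, E).prod 𝓘(ℝ, F × F)) 𝓘(ℝ, ℝ)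
    (fun z : TotalSpace (F × F) (V ×ᵇ V) => C.pairing z.proj z.2.1 z.2.2)
    (toTE₂ v p q).proj (toTE₂ v p q).2

/-- The canonical flip of `T(TM)`, which interchanges its two projections to `TM`. In the charts
of `TM` induced by charts of `M` it is `(x, v; x', v') ↦ (x, x'; v, v')`. -/
def canonicalFlip (ζ : TangentBundle (𝓘(ℝ, E).prod 𝓘(ℝ, E)) (TangentBundle 𝓘(ℝ, E) M)) :
    TangentBundle (𝓘(ℝ, E).prod 𝓘(ℝ, E)) (TangentBundle 𝓘(ℝ, E) M) :=
  ⟨⟨ζ.proj.proj, (show E × E from ζ.2).1⟩, ((show E from ζ.proj.2, (show E × E from ζ.2).2) : E × E)⟩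

/-- The tangent map `da : T𝔼 → T(TM)` of the anchor `a : 𝔼 → TM`, followed by the canonical flip. -/
def anchorTE (C : CourantAlgebroid E F V)
    (ξ : TangentBundle (𝓘(ℝ, E).prod 𝓘(ℝ, F)) (TotalSpace F V)) :
    TangentBundle (𝓘(ℝ, E).prod 𝓘(ℝ, E)) (TangentBundle 𝓘(ℝ, E) M) :=
  canonicalFlip (tangentMap (𝓘(ℝ, E).prod 𝓘(ℝ, F)) (𝓘(ℝ, E).prod 𝓘(ℝ, E))
    (fun e : TotalSpace F V => (⟨e.proj, C.anchor e.proj e.2⟩ : TangentBundle 𝓘(ℝ, E) M)) ξ)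

/-- The anchor of `T𝔼 → TM` on the fibre over `v`, a map to the tangent space of `TM` at `v`
(see `anchorTE_toTE`). -/
def anchorT (C : CourantAlgebroid E F V) (v : TangentBundle 𝓘(ℝ, E) M) (p : TFib F V v) :
    TangentSpace (𝓘(ℝ, E).prod 𝓘(ℝ, E)) v :=
  (anchorTE C (toTE v p)).2

theorem anchorTE_toTE (C : CourantAlgebroid E F V) (v : TangentBundle 𝓘(ℝ, E) M)
    (p : TFib F V v) : anchorTE C (toTE v p) = ⟨v, anchorT C v p⟩ := by
  let f : TotalSpace F V → TangentBundle 𝓘(ℝ, E) M := fun e => ⟨e.proj, C.anchor e.proj e.2⟩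
  let e := (toTE v p).proj
  have hA := (C.anchor_smooth.mdifferentiableAt (x := e) (by simp)).hasMFDerivAt
  have h := hasMFDerivAt_unique ((hasMFDerivAt_proj (E := E) (f e)).comp e hA)
    (hasMFDerivAt_proj (E := E) e)
  have h2 := congrArg (fun T : E × F →L[ℝ] E => T (toTE v p).2) h
  exact congrArg (fun X : TangentSpace 𝓘(ℝ, E) v.proj =>
    (⟨⟨v.proj, X⟩, (anchorT C v p)⟩ :
      TangentBundle (𝓘(ℝ, E).prod 𝓘(ℝ, E)) (TangentBundle 𝓘(ℝ, E) M))) h2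

/-- `a^* θ` for a covector `θ` of the manifold `TM` at `v`, in the fibre of `T𝔼 → TM` over `v`. -/
def coanchorT (C : CourantAlgebroid E F V) (v : TangentBundle 𝓘(ℝ, E) M)
    (θ : TangentSpace (𝓘(ℝ, E).prod 𝓘(ℝ, E)) v → ℝ) : TFib F V v :=
  Classical.epsilon fun b => ∀ q, pairingT C v b q = θ (anchorT C v q)

/-- The differential at `v` of a function on `TM`. -/
def dT (f : TangentBundle 𝓘(ℝ, E) M → ℝ) (v : TangentBundle 𝓘(ℝ, E) M)
    (ζ : TangentSpace (𝓘(ℝ, E).prod 𝓘(ℝ, E)) v) : ℝ :=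
  mfderiv (𝓘(ℝ, E).prod 𝓘(ℝ, E)) 𝓘(ℝ, ℝ) f v ζ

/-- An expression `s = ∑ i, (f i • (σ i)_T + g i • (σ i)_C)`, valid near `v`, of a section of
`T𝔼 → TM` through tangent lifts and core sections, with coefficients smooth at `v`. -/
structure Expansion (s : ∀ v : TangentBundle 𝓘(ℝ, E) M, TFib F V v)
    (v : TangentBundle 𝓘(ℝ, E) M) where
  n : ℕ
  σ : Fin n → Cₛ^∞⟮𝓘(ℝ, E); F, V⟯
  f : Fin n → TangentBundle 𝓘(ℝ, E) M → ℝ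
  g : Fin n → TangentBundle 𝓘(ℝ, E) M → ℝ
  smooth_f : ∀ i, ContMDiffAt (𝓘(ℝ, E).prod 𝓘(ℝ, E)) 𝓘(ℝ, ℝ) ∞ (f i) v
  smooth_g : ∀ i, ContMDiffAt (𝓘(ℝ, E).prod 𝓘(ℝ, E)) 𝓘(ℝ, ℝ) ∞ (g i) v
  eq : ∀ᶠ v' in 𝓝 v, s v' = ∑ i, (f i v' • liftT (σ i) v' + g i v' • liftC (σ i) v')

/-- The value at `v` of the Courant bracket of two sections `s`, `t` of `T𝔼 → TM` with expansions
`a`, `b`. It is obtained from the rules `⟦σ_T, τ_T⟧ = ⟦σ, τ⟧_T`,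
`⟦σ_T, τ_C⟧ = ⟦σ_C, τ_T⟧ = ⟦σ, τ⟧_C`, `⟦σ_C, τ_C⟧ = 0` by means of the Leibniz rules
`⟦s, f t⟧ = f ⟦s, t⟧ + (a(s) f) t` and
`⟦f s, t⟧ = f ⟦s, t⟧ - (a(t) f) s + ⟨s, t⟩ a^* df`. -/
def leibnizBracket (C : CourantAlgebroid E F V) (s t : ∀ v : TangentBundle 𝓘(ℝ, E) M, TFib F V v)
    (v : TangentBundle 𝓘(ℝ, E) M) (a : Expansion s v) (b : Expansion t v) : TFib F V v :=
  ∑ i, ∑ j, ((a.f i v * b.f j v) • liftT (C.bracket (a.σ i) (b.σ j)) v +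
      (a.f i v * b.g j v + a.g i v * b.f j v) • liftC (C.bracket (a.σ i) (b.σ j)) v) +
    ∑ j, (dT (b.f j) v (anchorT C v (s v)) • liftT (b.σ j) v +
      dT (b.g j) v (anchorT C v (s v)) • liftC (b.σ j) v) -
    ∑ i, (dT (a.f i) v (anchorT C v (t v)) • liftT (a.σ i) v +
      dT (a.g i) v (anchorT C v (t v)) • liftC (a.σ i) v) +
    ∑ i, (pairingT C v (liftT (a.σ i) v) (t v) • coanchorT C v (dT (a.f i) v) +
      pairingT C v (liftC (a.σ i) v) (t v) • coanchorT C v (dT (a.g i) v))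

/-- The Courant bracket of sections of `T𝔼 → TM`, computed with any local expansions. -/
def bracketT (C : CourantAlgebroid E F V) (s t : ∀ v : TangentBundle 𝓘(ℝ, E) M, TFib F V v)
    (v : TangentBundle 𝓘(ℝ, E) M) : TFib F V v :=
  Classical.epsilon fun p =>
    ∃ (a : Expansion s v) (b : Expansion t v), p = leibnizBracket C s t v a b

/-! ### `VB`-Dirac structures -/

/-- The family of subspaces `D b ⊆ T b`, `b ∈ S`, is locally spanned by smooth frames. -/
def HasSmoothFrames {B : Type*} [TopologicalSpace B] {T : B → Type*} [∀ b, AddCommGroup (T b)]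
    [∀ b, Module ℝ (T b)] (SmoothOn : (∀ b, T b) → Set B → Prop) (S : Set B)
    (D : ∀ b, Submodule ℝ (T b)) : Prop :=
  ∀ b₀ ∈ S, ∃ U : Set B, IsOpen U ∧ b₀ ∈ U ∧ ∃ (n : ℕ) (s : Fin n → ∀ b, T b),
    (∀ i, SmoothOn (s i) U) ∧
    ∀ b ∈ U ∩ S, LinearIndependent ℝ (fun i => s i b) ∧
      Submodule.span ℝ (range fun i => s i b) = D b

/-- `W` is a smooth vector subbundle of `𝔼 → M`. -/
def IsSubbundle (E : Type*) [NormedAddCommGroup E] [NormedSpace ℝ E] [ChartedSpace E M]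
    (F : Type*) [NormedAddCommGroup F] [NormedSpace ℝ F] [TopologicalSpace (TotalSpace F V)]
    [FiberBundle F V] (W : ∀ x, Submodule ℝ (V x)) : Prop :=
  HasSmoothFrames (fun s U => ContMDiffOn 𝓘(ℝ, E) (𝓘(ℝ, E).prod 𝓘(ℝ, F)) ∞
    (fun x => (⟨x, s x⟩ : TotalSpace F V)) U) univ W

/-- `L ⊆ T𝔼` is a double vector subbundle with side bundles `TM` and `W ⊆ 𝔼`: it is a smooth
vector subbundle of `T𝔼 → TM` (over all of `TM`), and a smooth vector subbundle of the restriction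
to `W` of the tangent bundle `T𝔼 → 𝔼`. -/
structure IsDoubleVectorSubbundle
    (L : Set (TangentBundle (𝓘(ℝ, E).prod 𝓘(ℝ, F)) (TotalSpace F V)))
    (W : ∀ x, Submodule ℝ (V x)) : Prop where
  side : IsSubbundle E F W
  over_TM : ∃ D : ∀ v : TangentBundle 𝓘(ℝ, E) M, Submodule ℝ (TFib F V v),
    (∀ v p, toTE v p ∈ L ↔ p ∈ D v) ∧
    HasSmoothFrames (fun s U => ContMDiffOn (𝓘(ℝ, E).prod 𝓘(ℝ, E))
      ((𝓘(ℝ, E).prod 𝓘(ℝ, F)).prod 𝓘(ℝ, E × F)) ∞ (fun v => toTE v (s v)) U) univ D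
  over_side : ∃ D : ∀ e : TotalSpace F V, Submodule ℝ (TangentSpace (𝓘(ℝ, E).prod 𝓘(ℝ, F)) e),
    (∀ ξ, ξ ∈ L ↔ ξ.proj.2 ∈ W ξ.proj.proj ∧ ξ.2 ∈ D ξ.proj) ∧
    HasSmoothFrames (fun s U => ContMDiffOn (𝓘(ℝ, E).prod 𝓘(ℝ, F))
      ((𝓘(ℝ, E).prod 𝓘(ℝ, F)).prod 𝓘(ℝ, E × F)) ∞
      (fun e => (⟨e, s e⟩ : TangentBundle (𝓘(ℝ, E).prod 𝓘(ℝ, F)) (TotalSpace F V))) U)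
      {e | e.2 ∈ W e.proj} D

/-- `s ∈ Γ(L, TM)`. -/
def IsSectionOf (L : Set (TangentBundle (𝓘(ℝ, E).prod 𝓘(ℝ, F)) (TotalSpace F V)))
    (s : ∀ v : TangentBundle 𝓘(ℝ, E) M, TFib F V v) : Prop :=
  IsSmoothSection s ∧ ∀ v, toTE v (s v) ∈ L

/-- `L ⊆ T𝔼` is a `VB`-Dirac structure with side bundle `W`: a double vector subbundle which is a
Dirac structure (Lagrangian and involutive) in the tangent prolongation `T𝔼 → TM`. -/
structure IsVBDirac (C : CourantAlgebroid E F V)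
    (L : Set (TangentBundle (𝓘(ℝ, E).prod 𝓘(ℝ, F)) (TotalSpace F V)))
    (W : ∀ x, Submodule ℝ (V x)) : Prop extends IsDoubleVectorSubbundle (E := E) L W where
  lagrangian : ∀ v p, toTE v p ∈ L ↔ ∀ q, toTE v q ∈ L → pairingT C v p q = 0
  involutive : ∀ s t, IsSectionOf (E := E) L s → IsSectionOf L t → IsSectionOf L (bracketT C s t)

/-! ### The pseudo-connection -/

/-- The space `Γ(W)` of smooth sections of `W ⊆ 𝔼`. -/
def sections (E : Type*) [NormedAddCommGroup E] [NormedSpace ℝ E] [ChartedSpace E M]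
    (F : Type*) [NormedAddCommGroup F] [NormedSpace ℝ F] [TopologicalSpace (TotalSpace F V)]
    [FiberBundle F V] [VectorBundle ℝ F V]
    (W : ∀ x, Submodule ℝ (V x)) : Submodule ℝ Cₛ^∞⟮𝓘(ℝ, E); F, V⟯ where
  carrier := {σ | ∀ x, σ x ∈ W x}
  add_mem' ha hb x := (W x).add_mem (ha x) (hb x)
  zero_mem' x := (W x).zero_mem
  smul_mem' c _ ha x := (W x).smul_mem c (ha x)

/-- The value at `x` of a section of `W`. -/
def value {W : ∀ x, Submodule ℝ (V x)} (σ : sections E F W) (x : M) : W x := ⟨σ.1 x, σ.2 x⟩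

/-- The double quotient map `q_L : T𝔼|_W → (T𝔼|_W) / L ≅ 𝔼 / W^⊥ ≅ W^*`. If `p` differs from an
element of `L` by the core element `c`, then `q_L p` is the class of `c` modulo `W^⊥`, that is, the
functional `⟨c, ·⟩` on `W`. -/
def quotientMap (C : CourantAlgebroid E F V)
    (L : Set (TangentBundle (𝓘(ℝ, E).prod 𝓘(ℝ, F)) (TotalSpace F V)))
    (W : ∀ x, Submodule ℝ (V x)) (v : TangentBundle 𝓘(ℝ, E) M) (p : TFib F V v) :
    W v.proj →ₗ[ℝ] ℝ :=
  (C.pairing v.proj (Classical.epsilon fun c => toTE v (p - core v c) ∈ L)).domRestrict (W v.proj)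

/-- The pseudo-connection `∇ : Γ(W) → Γ(T^*M ⊗ W^*)` associated to `L`, `∇ σ = q_L ∘ σ_T`; here
`nabla C L W σ x X` is `∇_X σ ∈ W_x^*`, for `X ∈ T_x M`. -/
def nabla (C : CourantAlgebroid E F V)
    (L : Set (TangentBundle (𝓘(ℝ, E).prod 𝓘(ℝ, F)) (TotalSpace F V)))
    (W : ∀ x, Submodule ℝ (V x)) (σ : sections E F W) (x : M) (X : TangentSpace 𝓘(ℝ, E) x) :
    W x →ₗ[ℝ] ℝ :=
  quotientMap C L W ⟨x, X⟩ (liftT σ.1 ⟨x, X⟩)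

/-! ### The bracket of the side bundle -/

/-- The section `s` of `T𝔼 → TM` is related to the section `σ` of `𝔼 → M` by the bundle
projection `q : T𝔼 → 𝔼`, that is, `q (s v) = σ x` for `v ∈ T_x M`. -/
def ProjectsTo (s : ∀ v : TangentBundle 𝓘(ℝ, E) M, TFib F V v) (σ : Cₛ^∞⟮𝓘(ℝ, E); F, V⟯) : Prop :=
  ∀ v, (s v).1 = σ v.proj

/-- `ρ` is the bracket of `σ` and `τ` inherited by `W` from the Lie algebroid `L → TM`, whose
bracket is the restriction of the Courant bracket: there are sections of `L → TM` that `q : L → W`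
relates to `σ` and `τ`, and the bracket of any such sections is related to `ρ`. -/
def IsInheritedBracket (C : CourantAlgebroid E F V)
    (L : Set (TangentBundle (𝓘(ℝ, E).prod 𝓘(ℝ, F)) (TotalSpace F V)))
    (σ τ ρ : Cₛ^∞⟮𝓘(ℝ, E); F, V⟯) : Prop :=
  (∃ s t, IsSectionOf L s ∧ IsSectionOf L t ∧ ProjectsTo s σ ∧ ProjectsTo t τ) ∧
  ∀ s t, IsSectionOf L s → IsSectionOf L t → ProjectsTo s σ → ProjectsTo t τ →
    ProjectsTo (bracketT C s t) ρ

/-- A Lie algebroid structure on the subbundle `W` of `𝔼 → M`. -/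
structure LieAlgebroid (E : Type*) [NormedAddCommGroup E] [NormedSpace ℝ E] [ChartedSpace E M]
    [IsManifold 𝓘(ℝ, E) ∞ M]
    (F : Type*) [NormedAddCommGroup F] [NormedSpace ℝ F] [TopologicalSpace (TotalSpace F V)]
    [FiberBundle F V] [VectorBundle ℝ F V] (W : ∀ x, Submodule ℝ (V x)) where
  bracket : sections E F W →ₗ[ℝ] sections E F W →ₗ[ℝ] sections E F W
  bracket_self : ∀ σ, bracket σ σ = 0
  jacobi : ∀ σ τ υ, bracket σ (bracket τ υ) = bracket (bracket σ τ) υ + bracket τ (bracket σ υ)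
  anchor : ∀ x, W x →ₗ[ℝ] TangentSpace 𝓘(ℝ, E) x
  anchor_smooth : ∀ σ : sections E F W, ContMDiff 𝓘(ℝ, E) (𝓘(ℝ, E).prod 𝓘(ℝ, E)) ∞
    (fun x => (⟨x, anchor x (value σ x)⟩ : TangentBundle 𝓘(ℝ, E) M))
  leibniz : ∀ (f : M → ℝ) (σ τ τ' : sections E F W), ContMDiff 𝓘(ℝ, E) 𝓘(ℝ, ℝ) ∞ f →
    (∀ x, value τ' x = f x • value τ x) → ∀ x, value (bracket σ τ') x =
      (show ℝ from mfderiv 𝓘(ℝ, E) 𝓘(ℝ, ℝ) f x (anchor x (value σ x))) • value τ x +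
        f x • value (bracket σ τ) x

/-- The Lie algebroid structure `A` on `W` is the one inherited from `L → TM`: the surjective
projection `q : L → W` over `TM → M` is a morphism of Lie algebroids, that is, it is compatible
with the anchors, and brackets of `q`-related sections are `q`-related. -/
structure IsInherited (C : CourantAlgebroid E F V)
    (L : Set (TangentBundle (𝓘(ℝ, E).prod 𝓘(ℝ, F)) (TotalSpace F V)))
    (W : ∀ x, Submodule ℝ (V x)) (A : LieAlgebroid E F W) : Prop where
  anchor : ∀ v p, toTE v p ∈ L → ∀ h : p.1 ∈ W v.proj,
    mfderiv (𝓘(ℝ, E).prod 𝓘(ℝ, E)) 𝓘(ℝ, E) (TotalSpace.proj : TangentBundle 𝓘(ℝ, E) M → M) v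
      (anchorT C v p) = A.anchor v.proj ⟨p.1, h⟩
  bracket : ∀ (σ τ : sections E F W) s t, IsSectionOf L s → IsSectionOf L t →
    ProjectsTo s σ.1 → ProjectsTo t τ.1 → ProjectsTo (bracketT C s t) (A.bracket σ τ).1

end Courant

end VBDirac

end

open VBDirac

/-! Lift `σ` and `τ` to sections `s`, `t` of `L → TM` and compute the `𝔼`-component of `⟦s, t⟧` at
`v = (x, X)`. Write `s = ∑ (f i • (σ i)_T + g i • (σ i)_C)` near `v`, and `t` likewise. Core
sections project to zero, so `σ = ∑ f i • σ i` along any vector field through `X`. The Leibniz rules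
of `𝔼`, which follow from the axioms, then expand `⟦σ, τ⟧` in the same way as the rules of `T𝔼`
expand the projection of `⟦s, t⟧`. The terms `(a(s) f) t` and `(a(t) f) s` agree in the two
expansions: `σ` and `τ` do not vary along the fibres of `TM`, so the vertical derivatives of the
coefficients cancel after summation (`Expansion.sum_dT`).

Only the `a^* d` terms differ. Pair with `u ∈ 𝔼_x` and put `Z = a(u)`. The anchor sends the core
element of `u` to the vertical vector of `Z`, so the prolongation contributes the vertical
derivatives of the `f i` and `g i` in the direction `Z`, weighted by `⟨(σ i)_T, t⟩` and `⟨(σ i)_C,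
t⟩`. For `𝔼` the term is `∑ (Z f i) ⟨σ i, τ⟩`. The discrepancy is `-⟨∇_Z σ, τ⟩`
(`IsVBDirac.sum_pairingT_vertical`). The reason is that `L` is linear over `W` and its core part
annihilates `W`; hence `⟨s, ·⟩` on `W` is affine along each fibre of `TM`, and its derivative in the
direction `Z` is its value over `Z`, which is what defines `∇_Z σ`.

Two facts about `L` are needed. Over every `v`, `L` projects onto all of `W_x` (`exists_mem`): this
is a rank count near the zero vector followed by scaling. Its core part pairs to zero with `W`
(`pairing_eq_zero`), because `L` is isotropic. The lifts exist by splitting `L → TM` locally along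
the image of `σ` and gluing with a partition of unity (`exists_lift`). Smoothness of the right-hand
side, and its lying in `W`, are read off from `⟦s, t⟧ ∈ Γ(L, TM)`. -/

noncomputable section

namespace VBDirac

/-! ### Differentials of maps into and out of the total space of a vector bundle, in preferred
charts. -/

section Calculus

variable {E : Type*} [NormedAddCommGroup E] [NormedSpace ℝ E]
  {M : Type*} [TopologicalSpace M] [ChartedSpace E M]
  {F : Type*} [NormedAddCommGroup F] [NormedSpace ℝ F]
  {V : M → Type*} [∀ x, AddCommGroup (V x)] [∀ x, Module ℝ (V x)] [∀ x, TopologicalSpace (V x)]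
  [TopologicalSpace (TotalSpace F V)] [FiberBundle F V] [VectorBundle ℝ F V]

/-- The preferred trivialization at `x`, on the fibre over `x`. -/
def fib (F : Type*) [NormedAddCommGroup F] [NormedSpace ℝ F]
    {V : M → Type*} [∀ x, AddCommGroup (V x)] [∀ x, Module ℝ (V x)] [∀ x, TopologicalSpace (V x)]
    [TopologicalSpace (TotalSpace F V)] [FiberBundle F V] [VectorBundle ℝ F V] (x : M) :
    V x ≃L[ℝ] F :=
  (trivializationAt F V x).continuousLinearEquivAt ℝ x (mem_baseSet_trivializationAt F V x)

theorem fib_apply (x : M) (c : V x) : fib F x c = (trivializationAt F V x ⟨x, c⟩).2 := rfl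

/-- The tangent vector of `x ↦ ⟨x, f x⟩` in the preferred chart, for a map into a bundle. -/
theorem hasMFDerivAt_totalSpace {EN : Type*} [NormedAddCommGroup EN] [NormedSpace ℝ EN]
    {HN : Type*} [TopologicalSpace HN] {I : ModelWithCorners ℝ EN HN}
    {N : Type*} [TopologicalSpace N] [ChartedSpace HN N] {f : N → TotalSpace F V} {n : N}
    {A : EN →L[ℝ] E} {B : EN →L[ℝ] F}
    (hA : HasMFDerivAt I 𝓘(ℝ, E) (fun y => (f y).proj) n A)
    (hB : HasMFDerivAt I 𝓘(ℝ, F) (fun y => (trivializationAt F V (f n).proj (f y)).2) n B) :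
    HasMFDerivAt I (𝓘(ℝ, E).prod 𝓘(ℝ, F)) f n (A.prod B) := by
  have hd : MDifferentiableAt I (𝓘(ℝ, E).prod 𝓘(ℝ, F)) f n :=
    (mdifferentiableAt_totalSpace _ f).2 ⟨hA.mdifferentiableAt, hB.mdifferentiableAt⟩
  refine ⟨hd.continuousAt, ?_⟩
  have h := hA.2.prodMk hB.2
  have hmem : (fun y => (f y).proj) ⁻¹' (trivializationAt F V (f n).proj).baseSet ∈ 𝓝 n :=
    hA.1.preimage_mem_nhds ((trivializationAt F V _).open_baseSet.mem_nhds
      (mem_baseSet_trivializationAt F V _))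
  have key : ∀ y, (f y).proj ∈ (trivializationAt F V (f n).proj).baseSet →
      extChartAt (𝓘(ℝ, E).prod 𝓘(ℝ, F)) (f n) (f y) =
        (extChartAt 𝓘(ℝ, E) (f n).proj (f y).proj,
          (trivializationAt F V (f n).proj (f y)).2) := by
    intro y hy
    rw [FiberBundle.extChartAt]
    simp only [PartialEquiv.trans_apply, PartialEquiv.prod_coe, PartialEquiv.refl_coe, id]
    refine Prod.ext ?_ rfl
    simp only
    congr 1
    exact Trivialization.coe_fst' _ hy
  refine h.congr_of_eventuallyEq ?_ ?_
  · have := extChartAt_preimage_mem_nhdsWithin (I := I) (x := n) (s := univ)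
      (t := (fun y => (f y).proj) ⁻¹' (trivializationAt F V (f n).proj).baseSet)
      (by simpa using hmem)
    filter_upwards [by simpa using this] with z hz
    exact key _ hz
  · simp only [writtenInExtChartAt, Function.comp]
    rw [extChartAt_to_inv]
    exact key n (mem_baseSet_trivializationAt F V _)

theorem hasMFDerivAt_section {σ : ∀ x, V x} {x : M}
    (h : MDifferentiableAt 𝓘(ℝ, E) (𝓘(ℝ, E).prod 𝓘(ℝ, F))
      (fun y => (⟨y, σ y⟩ : TotalSpace F V)) x) :
    HasMFDerivAt 𝓘(ℝ, E) (𝓘(ℝ, E).prod 𝓘(ℝ, F)) (fun y => (⟨y, σ y⟩ : TotalSpace F V)) x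
      ((ContinuousLinearMap.id ℝ E).prod
        (mfderiv 𝓘(ℝ, E) 𝓘(ℝ, F) (fun y => (trivializationAt F V x ⟨y, σ y⟩).2) x)) :=
  hasMFDerivAt_totalSpace (hasMFDerivAt_id x)
    (((mdifferentiableAt_totalSpace _ _).1 h).2.hasMFDerivAt)

theorem trivializationAt_snd_extend {x y : M} (e : V x)
    (hy : y ∈ (trivializationAt F V x).baseSet) :
    (trivializationAt F V x ⟨y, FiberBundle.extend F e y⟩).2 = fib F x e := by
  rw [FiberBundle.extend, Trivialization.apply_mk_symm _ hy]; rfl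

/-- `FiberBundle.extend F e` has constant coordinates in the trivialization at `x`, so its
derivative at `x` has no fibre part. It serves as the horizontal direction through `e`. -/
theorem hasMFDerivAt_extend {x : M} (e : V x) :
    HasMFDerivAt 𝓘(ℝ, E) (𝓘(ℝ, E).prod 𝓘(ℝ, F))
      (fun y => (⟨y, FiberBundle.extend F e y⟩ : TotalSpace F V)) x
      ((ContinuousLinearMap.id ℝ E).prod 0) := by
  refine hasMFDerivAt_totalSpace (hasMFDerivAt_id x) ?_
  refine (hasMFDerivAt_const (fib F x e) x).congr_of_eventuallyEq ?_
  filter_upwards [(trivializationAt F V x).open_baseSet.mem_nhds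
    (mem_baseSet_trivializationAt F V x)] with y hy using trivializationAt_snd_extend e hy

theorem extend_linear {x y : M} (hy : y ∈ (trivializationAt F V x).baseSet) :
    IsLinearMap ℝ (fun e : V x => FiberBundle.extend F e y) := by
  have h : (fun e : V x => FiberBundle.extend F e y) =
      fun e => (trivializationAt F V x).symmₗ ℝ y (fib F x e) := by
    funext e
    rw [Trivialization.coe_symmₗ _ hy]
    rfl
  rw [h]
  exact ⟨fun a b => by rw [map_add, map_add], fun c a => by rw [map_smul, map_smul]⟩

theorem hasMFDerivAt_line {x : M} (e c : V x) (r : ℝ) :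
    HasMFDerivAt 𝓘(ℝ, ℝ) (𝓘(ℝ, E).prod 𝓘(ℝ, F))
      (fun r : ℝ => (⟨x, e + r • c⟩ : TotalSpace F V)) r
      ((0 : ℝ →L[ℝ] E).prod (ContinuousLinearMap.toSpanSingleton ℝ (fib F x c))) := by
  refine hasMFDerivAt_totalSpace (hasMFDerivAt_const x r) ?_
  have h : HasFDerivAt (fun r : ℝ => fib F x e + r • fib F x c)
      (ContinuousLinearMap.toSpanSingleton ℝ (fib F x c)) r := by
    have := ((hasDerivAt_id r).smul_const (fib F x c)).const_add (fib F x e)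
    simpa [hasDerivAt_iff_hasFDerivAt] using this
  refine h.hasMFDerivAt.congr_of_eventuallyEq (Eventually.of_forall fun s => ?_)
  change fib F x (e + s • c) = _
  simp

/-- The differential of a map on a vector bundle, split into the derivative along the section with
constant coordinates and the derivative along the fibre. -/
theorem mfderiv_totalSpace_apply {EN : Type*} [NormedAddCommGroup EN] [NormedSpace ℝ EN]
    {HN : Type*} [TopologicalSpace HN] {I : ModelWithCorners ℝ EN HN}
    {N : Type*} [TopologicalSpace N] [ChartedSpace HN N] {Λ : TotalSpace F V → N} {x : M} {e : V x}
    (h : MDifferentiableAt (𝓘(ℝ, E).prod 𝓘(ℝ, F)) I Λ ⟨x, e⟩) (v : E) (w : F) :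
    (show EN from mfderiv (𝓘(ℝ, E).prod 𝓘(ℝ, F)) I Λ ⟨x, e⟩ ((v, w) : E × F)) =
      (show EN from mfderiv 𝓘(ℝ, E) I (fun y => Λ ⟨y, FiberBundle.extend F e y⟩) x v) +
      (show EN from mfderiv 𝓘(ℝ, ℝ) I (fun r : ℝ => Λ ⟨x, e + r • (fib F x).symm w⟩) 0
        (1 : ℝ)) := by
  have he : (⟨x, FiberBundle.extend F e x⟩ : TotalSpace F V) = ⟨x, e⟩ := by simp
  have he' : (⟨x, e + (0 : ℝ) • (fib F x).symm w⟩ : TotalSpace F V) = ⟨x, e⟩ := by simp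
  have hL := h.hasMFDerivAt
  have h1 := HasMFDerivAt.comp (x := x) (by rw [he]; exact hL) (hasMFDerivAt_extend (E := E) e)
  have h2 := HasMFDerivAt.comp (x := (0 : ℝ)) (by rw [he']; exact hL)
    (hasMFDerivAt_line (E := E) e ((fib F x).symm w) 0)
  have key : ∀ T : E × F →L[ℝ] EN, T (v, w) = T (v, 0) +
      T (0, (1 : ℝ) • fib F x ((fib F x).symm w : V x)) := fun T => by
    have hw : fib F x ((fib F x).symm w : V x) = w := (fib F x).apply_symm_apply w
    rw [← map_add, hw, Prod.mk_add_mk, add_zero, zero_add, one_smul]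
  have e1 := congrArg (fun T : E →L[ℝ] EN => T v) h1.mfderiv
  have e2 := congrArg (fun T : ℝ →L[ℝ] EN => T 1) h2.mfderiv
  exact (key _).trans (congrArg₂ (· + ·) e1 e2).symm

variable {G : Type*} [NormedAddCommGroup G] [NormedSpace ℝ G]

/-- Along a line in the fibre a fibrewise linear map is affine, so its vertical derivative is its
own value on the direction. -/
theorem mfderiv_fibrewiseLinear_apply {Λ : TotalSpace F V → G} {x : M} {e : V x}
    (h : MDifferentiableAt (𝓘(ℝ, E).prod 𝓘(ℝ, F)) 𝓘(ℝ, G) Λ ⟨x, e⟩)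
    (hl : IsLinearMap ℝ (fun e : V x => Λ ⟨x, e⟩)) (v : E) (w : F) :
    (show G from mfderiv (𝓘(ℝ, E).prod 𝓘(ℝ, F)) 𝓘(ℝ, G) Λ ⟨x, e⟩ ((v, w) : E × F)) =
      (show G from mfderiv 𝓘(ℝ, E) 𝓘(ℝ, G) (fun y => Λ ⟨y, FiberBundle.extend F e y⟩) x v) +
        Λ ⟨x, (fib F x).symm w⟩ := by
  refine (mfderiv_totalSpace_apply h v w).trans ?_
  congr 1
  have h1 : (fun r : ℝ => Λ ⟨x, e + r • (fib F x).symm w⟩) =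
      fun r => Λ ⟨x, e⟩ + r • Λ ⟨x, (fib F x).symm w⟩ := by
    funext r
    exact (hl.map_add _ _).trans (congrArg _ (hl.map_smul _ _))
  rw [h1]
  have h2 : HasDerivAt (fun r : ℝ => Λ ⟨x, e⟩ + r • Λ ⟨x, (fib F x).symm w⟩)
      ((1 : ℝ) • Λ ⟨x, (fib F x).symm w⟩) 0 :=
    ((hasDerivAt_id (0 : ℝ)).smul_const _).const_add _
  have h3 := congrArg (fun T : ℝ →L[ℝ] G => T 1) h2.hasFDerivAt.hasMFDerivAt.mfderiv
  refine h3.trans ?_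
  simp

/-- The tangent map of a fibrewise linear map is linear for the vector bundle structure over `TM`:
the base velocity `v` stays fixed while the base point `e` and the fibre velocity are added. The
horizontal part is linear in `e` because constant-coordinate extension is linear in `e`. -/
theorem isLinearMap_mfderiv_fibrewiseLinear {Λ : TotalSpace F V → G} {x : M}
    (h : ∀ e : V x, MDifferentiableAt (𝓘(ℝ, E).prod 𝓘(ℝ, F)) 𝓘(ℝ, G) Λ ⟨x, e⟩)
    (hl : ∀ᶠ y in 𝓝 x, IsLinearMap ℝ (fun e : V y => Λ ⟨y, e⟩)) (v : E) :
    IsLinearMap ℝ (fun p : V x × F => (show G from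
      mfderiv (𝓘(ℝ, E).prod 𝓘(ℝ, F)) 𝓘(ℝ, G) Λ ⟨x, p.1⟩ ((v, p.2) : E × F))) := by
  have hb := (trivializationAt F V x).open_baseSet.mem_nhds (mem_baseSet_trivializationAt F V x)
  have hd : ∀ e : V x, MDifferentiableAt 𝓘(ℝ, E) 𝓘(ℝ, G)
      (fun y => Λ ⟨y, FiberBundle.extend F e y⟩) x := fun e => by
    refine MDifferentiableAt.comp (x := x) (g := Λ)
      (f := fun y => (⟨y, FiberBundle.extend F e y⟩ : TotalSpace F V)) ?_
      (hasMFDerivAt_extend (E := E) e).mdifferentiableAt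
    simpa using h e
  constructor
  · intro p q
    refine (mfderiv_fibrewiseLinear_apply (h _) hl.self_of_nhds _ _).trans ?_
    refine Eq.trans ?_ (congrArg₂ (· + ·)
      (mfderiv_fibrewiseLinear_apply (h _) hl.self_of_nhds _ _).symm
      (mfderiv_fibrewiseLinear_apply (h _) hl.self_of_nhds _ _).symm)
    have h1 : (fun y => Λ ⟨y, FiberBundle.extend F (p + q).1 y⟩) =ᶠ[𝓝 x]
        (fun y => Λ ⟨y, FiberBundle.extend F p.1 y⟩) +
          fun y => Λ ⟨y, FiberBundle.extend F q.1 y⟩ := by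
      filter_upwards [hl, hb] with y hy hy'
      exact (congrArg (fun u => Λ ⟨y, u⟩) ((extend_linear hy').map_add p.1 q.1)).trans
        (hy.map_add _ _)
    have h2 := h1.mfderiv_eq (I := 𝓘(ℝ, E)) (I' := 𝓘(ℝ, G))
    have h3 := h2.trans (mfderiv_add (hd p.1) (hd q.1))
    have h4 := congrArg (fun T : E →L[ℝ] G => T v) h3
    have h5 : Λ ⟨x, (fib F x).symm (p + q).2⟩ =
        Λ ⟨x, (fib F x).symm p.2⟩ + Λ ⟨x, (fib F x).symm q.2⟩ := by
      rw [Prod.snd_add, map_add]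
      exact hl.self_of_nhds.map_add _ _
    refine (congrArg₂ (· + ·) h4 h5).trans ?_
    exact add_add_add_comm _ _ _ _
  · intro c p
    refine (mfderiv_fibrewiseLinear_apply (h _) hl.self_of_nhds _ _).trans ?_
    refine Eq.trans ?_ (congrArg (c • ·)
      (mfderiv_fibrewiseLinear_apply (h _) hl.self_of_nhds _ _).symm)
    have h1 : (fun y => Λ ⟨y, FiberBundle.extend F (c • p).1 y⟩) =ᶠ[𝓝 x]
        c • (fun y => Λ ⟨y, FiberBundle.extend F p.1 y⟩) := by
      filter_upwards [hl, hb] with y hy hy'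
      exact (congrArg (fun u => Λ ⟨y, u⟩) ((extend_linear hy').map_smul c p.1)).trans
        (hy.map_smul _ _)
    have h2 := h1.mfderiv_eq (I := 𝓘(ℝ, E)) (I' := 𝓘(ℝ, G))
    have h3 := h2.trans (const_smul_mfderiv (hd p.1) c)
    have h4 := congrArg (fun T : E →L[ℝ] G => T v) h3
    have h5 : Λ ⟨x, (fib F x).symm (c • p).2⟩ = c • Λ ⟨x, (fib F x).symm p.2⟩ := by
      rw [Prod.smul_snd, map_smul]
      exact hl.self_of_nhds.map_smul _ _
    refine (congrArg₂ (· + ·) h4 h5).trans ?_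
    exact (smul_add c _ _).symm

end Calculus

variable {E : Type*} [NormedAddCommGroup E] [NormedSpace ℝ E]
  {M : Type*} [TopologicalSpace M] [ChartedSpace E M] [IsManifold 𝓘(ℝ, E) ∞ M]
  {F : Type*} [NormedAddCommGroup F] [NormedSpace ℝ F]
  {V : M → Type*} [∀ x, AddCommGroup (V x)] [∀ x, Module ℝ (V x)] [∀ x, TopologicalSpace (V x)]
  [TopologicalSpace (TotalSpace F V)] [FiberBundle F V] [VectorBundle ℝ F V]
  [ContMDiffVectorBundle ∞ F V 𝓘(ℝ, E)]

/-! ### Tangent lifts and core elements in coordinates. -/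

section Lifts

theorem core_eq (v : TangentBundle 𝓘(ℝ, E) M) (c : V v.proj) :
    (core v c : TFib F V v) = (0, fib F v.proj c) := by
  have h := (hasMFDerivAt_line (E := E) (F := F) (0 : V v.proj) c 0).mfderiv
  have h1 : (fun r : ℝ => (⟨v.proj, (0 : V v.proj) + r • c⟩ : TotalSpace F V)) =
      fun r => ⟨v.proj, r • c⟩ := by
    funext r; rw [zero_add]
  rw [h1] at h
  have h2 := congrArg (fun T : ℝ →L[ℝ] E × F => (T 1).2) h
  refine Prod.ext rfl (h2.trans ?_)
  simp

/-- The derivative at `x` of a section, in the preferred trivialization at `x`. -/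
def sectionDeriv (σ : ∀ x, V x) (x : M) : TangentSpace 𝓘(ℝ, E) x →L[ℝ] F :=
  mvfderiv 𝓘(ℝ, E) (fun y => (trivializationAt F V x ⟨y, σ y⟩).2) x

theorem mdifferentiableAt_coe (σ : Cₛ^∞⟮𝓘(ℝ, E); F, V⟯) (x : M) :
    MDifferentiableAt 𝓘(ℝ, E) (𝓘(ℝ, E).prod 𝓘(ℝ, F)) (fun y => (⟨y, σ y⟩ : TotalSpace F V)) x :=
  σ.mdifferentiableAt

theorem liftT_eq (σ : Cₛ^∞⟮𝓘(ℝ, E); F, V⟯) (v : TangentBundle 𝓘(ℝ, E) M) :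
    liftT σ v = (σ v.proj, sectionDeriv (E := E) (F := F) σ v.proj v.2) := by
  have h := (hasMFDerivAt_section (mdifferentiableAt_coe σ v.proj)).mfderiv
  exact Prod.ext rfl (congrArg (fun T : E →L[ℝ] E × F => (T v.2).2) h)

theorem liftC_eq (σ : Cₛ^∞⟮𝓘(ℝ, E); F, V⟯) (v : TangentBundle 𝓘(ℝ, E) M) :
    liftC σ v = (0, fib F v.proj (σ v.proj)) := core_eq v _

theorem fib_tangentSpace (x : M) (X : TangentSpace 𝓘(ℝ, E) x) :
    fib E x X = (show E from X) := by
  rw [fib_apply, TangentBundle.trivializationAt_apply]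
  exact tangentCoordChange_self (I := 𝓘(ℝ, E)) (x := x) (z := x) (v := X) (mem_extChartAt_source x)

end Lifts

/-! ### The pairing and the anchor of `T𝔼 → TM` in coordinates. -/

section Prolongation

theorem extend_prod {x y : M} (p q : V x) (hy : y ∈ (trivializationAt F V x).baseSet) :
    FiberBundle.extend (F × F) (E := V ×ᵇ V) (p, q) y =
      (FiberBundle.extend F p y, FiberBundle.extend F q y) := by
  have hy' : y ∈ (trivializationAt (F × F) (V ×ᵇ V) x).baseSet := ⟨hy, hy⟩
  have h : Function.Injective (fun u : (V ×ᵇ V) y =>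
      (trivializationAt (F × F) (V ×ᵇ V) x ⟨y, u⟩).2) :=
    ((trivializationAt (F × F) (V ×ᵇ V) x).continuousLinearEquivAt ℝ y hy').injective
  apply h
  exact (trivializationAt_snd_extend (F := F × F) (V := V ×ᵇ V) (p, q) hy').trans
    (Prod.ext (trivializationAt_snd_extend p hy).symm (trivializationAt_snd_extend q hy).symm)

theorem mdifferentiableAt_pairing (C : CourantAlgebroid E F V) {x : M} (p q : V x) :
    MDifferentiableAt (𝓘(ℝ, E).prod 𝓘(ℝ, F × F)) 𝓘(ℝ, ℝ)
      (fun z : TotalSpace (F × F) (V ×ᵇ V) => C.pairing z.proj z.2.1 z.2.2) ⟨x, (p, q)⟩ :=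
  C.pairing_smooth.mdifferentiableAt (by simp)

theorem hasMFDerivAt_prodSection {σ τ : ∀ x, V x} {x : M}
    (hσ : MDifferentiableAt 𝓘(ℝ, E) (𝓘(ℝ, E).prod 𝓘(ℝ, F))
      (fun y => (⟨y, σ y⟩ : TotalSpace F V)) x)
    (hτ : MDifferentiableAt 𝓘(ℝ, E) (𝓘(ℝ, E).prod 𝓘(ℝ, F))
      (fun y => (⟨y, τ y⟩ : TotalSpace F V)) x) :
    MDifferentiableAt 𝓘(ℝ, E) (𝓘(ℝ, E).prod 𝓘(ℝ, F × F))
      (fun y => (⟨y, (σ y, τ y)⟩ : TotalSpace (F × F) (V ×ᵇ V))) x := by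
  rw [mdifferentiableAt_totalSpace] at hσ hτ ⊢
  exact ⟨mdifferentiableAt_id, hσ.2.prodMk_space hτ.2⟩

theorem mdifferentiableAt_pairing_section (C : CourantAlgebroid E F V) {σ τ : ∀ x, V x} {x : M}
    (hσ : MDifferentiableAt 𝓘(ℝ, E) (𝓘(ℝ, E).prod 𝓘(ℝ, F))
      (fun y => (⟨y, σ y⟩ : TotalSpace F V)) x)
    (hτ : MDifferentiableAt 𝓘(ℝ, E) (𝓘(ℝ, E).prod 𝓘(ℝ, F))
      (fun y => (⟨y, τ y⟩ : TotalSpace F V)) x) :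
    MDifferentiableAt 𝓘(ℝ, E) 𝓘(ℝ, ℝ) (fun y => C.pairing y (σ y) (τ y)) x :=
  (mdifferentiableAt_pairing C (σ x) (τ x)).comp x (hasMFDerivAt_prodSection hσ hτ)

/-- The derivative at `x`, in the direction `X`, of the pairing of the two sections with constant
coordinates through `e` and `e'`. -/
def pairingBase (C : CourantAlgebroid E F V) (x : M) (X : TangentSpace 𝓘(ℝ, E) x) (e e' : V x) :
    ℝ :=
  (mfderiv 𝓘(ℝ, E) 𝓘(ℝ, ℝ) (fun y => C.pairing y (FiberBundle.extend F e y)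
    (FiberBundle.extend F e' y)) x : E →L[ℝ] ℝ) X

theorem pairingBase_symm (C : CourantAlgebroid E F V) (x : M) (X : TangentSpace 𝓘(ℝ, E) x)
    (e e' : V x) :
    pairingBase C x X e e' = pairingBase C x X e' e := by
  have h : (fun y => C.pairing y (FiberBundle.extend F e y) (FiberBundle.extend F e' y)) =
      fun y => C.pairing y (FiberBundle.extend F e' y) (FiberBundle.extend F e y) :=
    funext fun y => C.pairing_symm y _ _
  rw [pairingBase, h]; rfl

theorem isLinearMap_pairingBase (C : CourantAlgebroid E F V) (x : M) (X : TangentSpace 𝓘(ℝ, E) x)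
    (e' : V x) :
    IsLinearMap ℝ (fun e => pairingBase C x X e e') := by
  have hb := (trivializationAt F V x).open_baseSet.mem_nhds (mem_baseSet_trivializationAt F V x)
  have hd : ∀ p : V x, MDifferentiableAt 𝓘(ℝ, E) 𝓘(ℝ, ℝ)
      (fun y => C.pairing y (FiberBundle.extend F p y) (FiberBundle.extend F e' y)) x :=
    fun p => mdifferentiableAt_pairing_section C
      (hasMFDerivAt_extend (E := E) p).mdifferentiableAt
      (hasMFDerivAt_extend (E := E) e').mdifferentiableAt
  constructor
  · intro p p'
    have h1 : (fun y => C.pairing y (FiberBundle.extend F (p + p') y)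
          (FiberBundle.extend F e' y)) =ᶠ[𝓝 x]
        (fun y => C.pairing y (FiberBundle.extend F p y) (FiberBundle.extend F e' y)) +
        (fun y => C.pairing y (FiberBundle.extend F p' y) (FiberBundle.extend F e' y)) := by
      filter_upwards [hb] with y hy
      have := (extend_linear hy).map_add p p'
      simp only [this, map_add, LinearMap.add_apply, Pi.add_apply]
    exact congrArg (fun T : E →L[ℝ] ℝ => T X)
      ((h1.mfderiv_eq (I := 𝓘(ℝ, E)) (I' := 𝓘(ℝ, ℝ))).trans (mfderiv_add (hd p) (hd p')))
  · intro c p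
    have h1 : (fun y => C.pairing y (FiberBundle.extend F (c • p) y)
          (FiberBundle.extend F e' y)) =ᶠ[𝓝 x]
        c • (fun y => C.pairing y (FiberBundle.extend F p y) (FiberBundle.extend F e' y)) := by
      filter_upwards [hb] with y hy
      have := (extend_linear hy).map_smul c p
      simp only [this, map_smul, LinearMap.smul_apply, Pi.smul_apply]
    exact congrArg (fun T : E →L[ℝ] ℝ => T X)
      ((h1.mfderiv_eq (I := 𝓘(ℝ, E)) (I' := 𝓘(ℝ, ℝ))).trans (const_smul_mfderiv (hd p) c))

/-- The tangent map of the pairing, in the preferred trivialization. -/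
theorem pairingT_eq (C : CourantAlgebroid E F V) (v : TangentBundle 𝓘(ℝ, E) M)
    (p q : TFib F V v) :
    pairingT C v p q =
      pairingBase C v.proj v.2 p.1 q.1 +
      (C.pairing v.proj ((fib F v.proj).symm p.2) q.1 +
        C.pairing v.proj p.1 ((fib F v.proj).symm q.2)) := by
  refine (mfderiv_totalSpace_apply (mdifferentiableAt_pairing C p.1 q.1) v.2 (p.2, q.2)).trans ?_
  have hs : (fib (F × F) (V := V ×ᵇ V) v.proj).symm (p.2, q.2) =
      (((fib F v.proj).symm p.2, (fib F v.proj).symm q.2) : (V ×ᵇ V) v.proj) := by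
    rw [ContinuousLinearEquiv.symm_apply_eq]
    exact Prod.ext ((fib F v.proj).apply_symm_apply p.2).symm
      ((fib F v.proj).apply_symm_apply q.2).symm
  rw [hs]
  congr 1
  · have h1 : (fun y => C.pairing y (FiberBundle.extend (F × F) (E := V ×ᵇ V) (p.1, q.1) y).1
        (FiberBundle.extend (F × F) (E := V ×ᵇ V) (p.1, q.1) y).2) =ᶠ[𝓝 v.proj]
        (fun y => C.pairing y (FiberBundle.extend F p.1 y) (FiberBundle.extend F q.1 y)) := by
      filter_upwards [(trivializationAt F V v.proj).open_baseSet.mem_nhds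
        (mem_baseSet_trivializationAt F V v.proj)] with y hy
      rw [extend_prod _ _ hy]
    exact congrArg (fun T : E →L[ℝ] ℝ => T v.2) (h1.mfderiv_eq (I := 𝓘(ℝ, E)) (I' := 𝓘(ℝ, ℝ)))
  · set a : V v.proj := (fib F v.proj).symm p.2
    set b : V v.proj := (fib F v.proj).symm q.2
    -- When both arguments move along lines in the fibre, the pairing is a quadratic polynomial in
    -- `r`; its linear coefficient is the derivative at `0`.
    have h2 : HasDerivAt (fun r : ℝ => C.pairing v.proj p.1 q.1 +
        (r * (C.pairing v.proj a q.1 + C.pairing v.proj p.1 b) +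
        r * r * C.pairing v.proj a b))
        (C.pairing v.proj a q.1 + C.pairing v.proj p.1 b) 0 := by
      have := (((hasDerivAt_id (0 : ℝ)).mul_const
        (C.pairing v.proj a q.1 + C.pairing v.proj p.1 b)).add
        (((hasDerivAt_id (0 : ℝ)).mul (hasDerivAt_id (0 : ℝ))).mul_const
          (C.pairing v.proj a b))).const_add (C.pairing v.proj p.1 q.1)
      refine (this.congr_deriv ?_)
      simp
    have h3 : (fun r : ℝ => C.pairing v.proj (p.1 + r • a) (q.1 + r • b)) =
        fun r : ℝ => C.pairing v.proj p.1 q.1 +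
        (r * (C.pairing v.proj a q.1 + C.pairing v.proj p.1 b) +
        r * r * C.pairing v.proj a b) := by
      funext r
      simp only [map_add, map_smul, LinearMap.add_apply, LinearMap.smul_apply, smul_eq_mul]
      ring
    rw [← h3] at h2
    have h4 := congrArg (fun T : ℝ →L[ℝ] ℝ => T 1) h2.hasFDerivAt.hasMFDerivAt.mfderiv
    refine Eq.trans h4 ?_
    simp

theorem pairingT_symm (C : CourantAlgebroid E F V) (v : TangentBundle 𝓘(ℝ, E) M)
    (p q : TFib F V v) : pairingT C v p q = pairingT C v q p := by
  rw [pairingT_eq, pairingT_eq, C.pairing_symm _ _ q.1, C.pairing_symm _ p.1, add_comm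
    (C.pairing v.proj q.1 _), pairingBase_symm]

theorem isLinearMap_pairingT (C : CourantAlgebroid E F V) (v : TangentBundle 𝓘(ℝ, E) M)
    (q : TFib F V v) : IsLinearMap ℝ (fun p => pairingT C v p q) := by
  have h := isLinearMap_pairingBase C v.proj v.2 q.1
  constructor
  · intro p p'
    simp only [pairingT_eq, Prod.fst_add, Prod.snd_add, map_add, LinearMap.add_apply,
      h.map_add p.1 p'.1]
    ring
  · intro c p
    simp only [pairingT_eq, Prod.smul_fst, Prod.smul_snd, map_smul, LinearMap.smul_apply,
      smul_eq_mul, h.map_smul c p.1]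
    ring

/-- The pairing on the fibres of `T𝔼 → TM` as a bilinear map. -/
def pairingTₗ (C : CourantAlgebroid E F V) (v : TangentBundle 𝓘(ℝ, E) M) :
    TFib F V v →ₗ[ℝ] TFib F V v →ₗ[ℝ] ℝ :=
  LinearMap.mk₂ ℝ (pairingT C v) (fun p p' q => (isLinearMap_pairingT C v q).map_add p p')
    (fun c p q => (isLinearMap_pairingT C v q).map_smul c p)
    (fun p q q' => by
      simp only [pairingT_symm C v p]; exact (isLinearMap_pairingT C v p).map_add q q')
    (fun c p q => by
      simp only [pairingT_symm C v p]; exact (isLinearMap_pairingT C v p).map_smul c q)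

theorem pairingTₗ_apply (C : CourantAlgebroid E F V) (v : TangentBundle 𝓘(ℝ, E) M)
    (p q : TFib F V v) : pairingTₗ C v p q = pairingT C v p q := rfl

theorem pairingT_vertical (C : CourantAlgebroid E F V) (v : TangentBundle 𝓘(ℝ, E) M)
    (w : F) (q : TFib F V v) :
    pairingT C v (0, w) q = C.pairing v.proj ((fib F v.proj).symm w) q.1 := by
  rw [pairingT_eq, (isLinearMap_pairingBase C v.proj v.2 q.1).map_zero]
  simp

/-- Pairing with core elements sees only the projection to `𝔼`. This is how projections of elements
of `T𝔼` are computed below. -/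
theorem pairingT_core_left (C : CourantAlgebroid E F V) (v : TangentBundle 𝓘(ℝ, E) M)
    (c : V v.proj) (q : TFib F V v) :
    pairingT C v (core v c) q = C.pairing v.proj c q.1 := by
  rw [core_eq, pairingT_vertical, ContinuousLinearEquiv.symm_apply_apply]

/-- Testing against core elements kills the projection to `𝔼`. What remains is vertical, and is
tested through the pairing of `𝔼` itself. -/
theorem pairingT_nondeg (C : CourantAlgebroid E F V) (v : TangentBundle 𝓘(ℝ, E) M)
    (p : TFib F V v) (h : ∀ q, pairingT C v p q = 0) : p = 0 := by
  obtain ⟨e, w⟩ := p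
  have he : e = 0 := C.pairing_nondeg _ _ fun c => by
    rw [C.pairing_symm, ← pairingT_core_left C v c (e, w), pairingT_symm, h]
  subst he
  have hw : (fib F v.proj).symm w = 0 := C.pairing_nondeg _ _ fun c => by
    rw [← pairingT_vertical C v w (c, 0), h]
  rw [map_eq_zero_iff _ (fib F v.proj).symm.injective] at hw
  rw [hw]; rfl

/-! The anchor -/

/-- The anchor in the preferred trivialization of `TM` at `x`. -/
def anchorCoord (C : CourantAlgebroid E F V) (x : M) (e : TotalSpace F V) : E :=
  (trivializationAt E (TangentSpace 𝓘(ℝ, E)) x ⟨e.proj, C.anchor e.proj e.2⟩).2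

theorem mdifferentiableAt_anchorCoord (C : CourantAlgebroid E F V) (x : M) (p : V x) :
    MDifferentiableAt (𝓘(ℝ, E).prod 𝓘(ℝ, F)) 𝓘(ℝ, E) (anchorCoord C x) ⟨x, p⟩ :=
  ((mdifferentiableAt_totalSpace _ _).1
    (C.anchor_smooth.mdifferentiableAt (x := (⟨x, p⟩ : TotalSpace F V)) (by simp))).2

theorem anchorCoord_linear (C : CourantAlgebroid E F V) (x : M) :
    ∀ᶠ y in 𝓝 x, IsLinearMap ℝ (fun e : V y => anchorCoord C x ⟨y, e⟩) := by
  filter_upwards [(trivializationAt E (TangentSpace 𝓘(ℝ, E)) x).open_baseSet.mem_nhds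
    (mem_baseSet_trivializationAt E (TangentSpace 𝓘(ℝ, E)) x)] with y hy
  have h := (trivializationAt E (TangentSpace 𝓘(ℝ, E)) x).linear ℝ hy
  exact ⟨fun a b => by
      simp only [anchorCoord, map_add]; exact h.map_add _ _,
    fun c a => by
      simp only [anchorCoord, map_smul]; exact h.map_smul _ _⟩

theorem anchorT_eq (C : CourantAlgebroid E F V) (v : TangentBundle 𝓘(ℝ, E) M)
    (p : TFib F V v) :
    (show E × E from anchorT C v p) = (show E from C.anchor v.proj p.1,
      show E from mfderiv (𝓘(ℝ, E).prod 𝓘(ℝ, F)) 𝓘(ℝ, E) (anchorCoord C v.proj) ⟨v.proj, p.1⟩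
        ((show E from v.2, p.2) : E × F)) := by
  have hd := (mdifferentiableAt_totalSpace _ _).1
    (C.anchor_smooth.mdifferentiableAt (x := (⟨v.proj, p.1⟩ : TotalSpace F V)) (by simp))
  have h := (hasMFDerivAt_totalSpace hd.1.hasMFDerivAt hd.2.hasMFDerivAt).mfderiv
  exact Prod.ext rfl
    (congrArg (fun T : E × F →L[ℝ] E × E => (T ((show E from v.2, p.2) : E × F)).2) h)

theorem anchorT_isLinear (C : CourantAlgebroid E F V) (v : TangentBundle 𝓘(ℝ, E) M) :
    IsLinearMap ℝ (fun p : TFib F V v => (show E × E from anchorT C v p)) := by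
  have h := isLinearMap_mfderiv_fibrewiseLinear (x := v.proj)
    (mdifferentiableAt_anchorCoord C v.proj) (anchorCoord_linear C v.proj) v.2
  constructor
  · intro p q
    simp only [anchorT_eq]
    refine Prod.ext ?_ (h.map_add p q)
    exact (C.anchor v.proj).map_add p.1 q.1
  · intro c p
    simp only [anchorT_eq]
    refine Prod.ext ?_ (h.map_smul c p)
    exact (C.anchor v.proj).map_smul c p.1

/-- At a zero of `𝔼` the horizontal derivative of the fibrewise linear anchor vanishes, and the
vertical one is the anchor itself. So core elements act on `TM` by vertical vectors. -/
theorem anchorT_core (C : CourantAlgebroid E F V) (v : TangentBundle 𝓘(ℝ, E) M) (c : V v.proj) :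
    (show E × E from anchorT C v (core v c)) = (0, show E from C.anchor v.proj c) := by
  rw [anchorT_eq, core_eq]
  refine Prod.ext ((C.anchor v.proj).map_zero) ?_
  refine (mfderiv_fibrewiseLinear_apply (mdifferentiableAt_anchorCoord C v.proj 0)
    (anchorCoord_linear C v.proj).self_of_nhds v.2 _).trans ?_
  rw [ContinuousLinearEquiv.symm_apply_apply]
  have h1 : (fun y => anchorCoord C v.proj ⟨y, FiberBundle.extend F (0 : V v.proj) y⟩)
      =ᶠ[𝓝 v.proj] fun _ => (0 : E) := by
    filter_upwards [(trivializationAt F V v.proj).open_baseSet.mem_nhds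
      (mem_baseSet_trivializationAt F V v.proj), anchorCoord_linear C v.proj] with y hy hl
    rw [(extend_linear hy).map_zero]
    exact hl.map_zero
  have h2 := congrArg (fun T : E →L[ℝ] E => T v.2)
    ((h1.mfderiv_eq (I := 𝓘(ℝ, E)) (I' := 𝓘(ℝ, E))).trans (mfderiv_const))
  refine (congrArg (· + _) h2).trans ?_
  refine (zero_add _).trans ?_
  exact fib_tangentSpace v.proj (C.anchor v.proj c)

end Prolongation

/-! ### Derivatives of finite sums of products. -/

section ProductRule

variable {EN : Type*} [NormedAddCommGroup EN] [NormedSpace ℝ EN]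
  {HN : Type*} [TopologicalSpace HN] {I : ModelWithCorners ℝ EN HN}
  {N : Type*} [TopologicalSpace N] [ChartedSpace HN N]
  {G : Type*} [NormedAddCommGroup G] [NormedSpace ℝ G]

theorem mdifferentiableAt_finset_sum {ι : Type*} (s : Finset ι) {g : ι → N → G} {x : N}
    (hg : ∀ i, MDifferentiableAt I 𝓘(ℝ, G) (g i) x) :
    MDifferentiableAt I 𝓘(ℝ, G) (fun y => ∑ i ∈ s, g i y) x := by
  classical
  induction s using Finset.induction_on with
  | empty => simpa using mdifferentiableAt_const
  | insert i s hi ih =>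
    simp only [Finset.sum_insert hi]
    exact (hg i).add ih

theorem mvfderiv_finset_sum {ι : Type*} (s : Finset ι) {g : ι → N → G} {x : N}
    (hg : ∀ i, MDifferentiableAt I 𝓘(ℝ, G) (g i) x) (X : TangentSpace I x) :
    mvfderiv I (fun y => ∑ i ∈ s, g i y) x X = ∑ i ∈ s, mvfderiv I (g i) x X := by
  classical
  induction s using Finset.induction_on with
  | empty => simp [mvfderiv_const]
  | insert i s hi ih =>
    simp only [Finset.sum_insert hi, ← ih]
    have h := mvfderiv_add (hg i) (mdifferentiableAt_finset_sum s hg)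
    exact congrArg (fun T : TangentSpace I x →L[ℝ] G => T X) h

theorem mvfderiv_congr {f g : N → G} {x : N} (h : f =ᶠ[𝓝 x] g) :
    mvfderiv I f x = (mvfderiv I g x : TangentSpace I x →L[ℝ] G) := by
  ext X
  exact congrArg (fun T : EN →L[ℝ] G => T X) (h.mfderiv_eq (I := I) (I' := 𝓘(ℝ, G)))

/-- The product rule for `f = ∑ i, φ i • g i` near `x`. -/
theorem mvfderiv_of_eventually_eq_sum_smul {ι : Type*} [Fintype ι] {f : N → G} {φ : ι → N → ℝ}
    {g : ι → N → G} {x : N} (hφ : ∀ i, MDifferentiableAt I 𝓘(ℝ, ℝ) (φ i) x)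
    (hg : ∀ i, MDifferentiableAt I 𝓘(ℝ, G) (g i) x)
    (hf : ∀ᶠ y in 𝓝 x, f y = ∑ i, φ i y • g i y) (X : TangentSpace I x) :
    mvfderiv I f x X = ∑ i, (φ i x • mvfderiv I (g i) x X + mvfderiv I (φ i) x X • g i x) := by
  rw [mvfderiv_congr hf]
  refine (mvfderiv_finset_sum Finset.univ (fun i => (hφ i).smul (hg i)) X).trans ?_
  refine Finset.sum_congr rfl fun i _ => ?_
  have h := mvfderiv_smul (hφ i) (hg i)
  exact congrArg (fun T : TangentSpace I x →L[ℝ] G => T X) h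

end ProductRule

/-! ### The dual anchors, and the splitting of differentials on `TM`. -/

section Coanchor

variable [FiniteDimensional ℝ F]

theorem exists_representing {U : Type*} [AddCommGroup U] [Module ℝ U] [FiniteDimensional ℝ U]
    (B : U →ₗ[ℝ] U →ₗ[ℝ] ℝ) (hB : ∀ u, (∀ w, B u w = 0) → u = 0) (φ : U →ₗ[ℝ] ℝ) :
    ∃ b, ∀ u, B b u = φ u := by
  have hinj : Function.Injective B := by
    rw [← LinearMap.ker_eq_bot, LinearMap.ker_eq_bot']
    exact fun u hu => hB u fun w => by rw [hu]; rfl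
  have hsurj := (LinearMap.injective_iff_surjective_of_finrank_eq_finrank
    (Subspace.dual_finrank_eq (K := ℝ) (V := U)).symm).1 hinj
  obtain ⟨b, hb⟩ := hsurj φ
  exact ⟨b, fun u => by rw [hb]⟩

theorem finiteDimensional_fibre (F : Type*) [NormedAddCommGroup F] [NormedSpace ℝ F]
    [FiniteDimensional ℝ F]
    {V : M → Type*} [∀ x, AddCommGroup (V x)] [∀ x, Module ℝ (V x)] [∀ x, TopologicalSpace (V x)]
    [TopologicalSpace (TotalSpace F V)] [FiberBundle F V] [VectorBundle ℝ F V] (x : M) :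
    FiniteDimensional ℝ (V x) :=
  (fib F x).symm.toLinearEquiv.finiteDimensional

/-- `coanchor` is a choice of element and accepts arbitrary functions `θ`. Linearity of `θ` makes `θ
∘ a` representable through the nondegenerate pairing, so the choice is meaningful. -/
theorem coanchor_spec (C : CourantAlgebroid E F V) (x : M) (θ : TangentSpace 𝓘(ℝ, E) x → ℝ)
    (hθ : IsLinearMap ℝ θ) (u : V x) :
    C.pairing x (C.coanchor x θ) u = θ (C.anchor x u) := by
  have := finiteDimensional_fibre F (V := V) x
  have h := exists_representing (C.pairing x) (C.pairing_nondeg x)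
    ((hθ.mk' θ).comp (C.anchor x))
  exact Classical.epsilon_spec (p := fun b => ∀ u, C.pairing x b u = θ (C.anchor x u)) h u

theorem coanchorT_spec (C : CourantAlgebroid E F V) (v : TangentBundle 𝓘(ℝ, E) M)
    (θ : TangentSpace (𝓘(ℝ, E).prod 𝓘(ℝ, E)) v → ℝ) (hθ : IsLinearMap ℝ θ) (q : TFib F V v) :
    pairingT C v (coanchorT C v θ) q = θ (anchorT C v q) := by
  have := finiteDimensional_fibre F (V := V) v.proj
  have hA : IsLinearMap ℝ (fun p : TFib F V v => anchorT C v p) :=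
    ⟨(anchorT_isLinear C v).map_add, (anchorT_isLinear C v).map_smul⟩
  have h := exists_representing (pairingTₗ C v) (fun u hu => pairingT_nondeg C v u hu)
    ((hθ.mk' θ).comp (hA.mk' _))
  exact Classical.epsilon_spec (p := fun b => ∀ q, pairingT C v b q = θ (anchorT C v q)) h q

theorem isLinearMap_dT (f : TangentBundle 𝓘(ℝ, E) M → ℝ) (v : TangentBundle 𝓘(ℝ, E) M) :
    IsLinearMap ℝ (dT f v) :=
  (mvfderiv (𝓘(ℝ, E).prod 𝓘(ℝ, E)) f v).toLinearMap.isLinear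

/-- Pairing with the core element of `u` extracts the projection, and its anchor is vertical. Hence
only the derivative of `f` along the fibre of `TM` survives; this is the source of the correction
term. -/
theorem pairing_coanchorT_fst (C : CourantAlgebroid E F V) (v : TangentBundle 𝓘(ℝ, E) M)
    (f : TangentBundle 𝓘(ℝ, E) M → ℝ) (u : V v.proj) :
    C.pairing v.proj (coanchorT C v (dT f v)).1 u =
      dT f v ((0, show E from C.anchor v.proj u) : E × E) := by
  rw [C.pairing_symm, ← pairingT_core_left, pairingT_symm,
    coanchorT_spec C v _ (isLinearMap_dT f v)]
  exact congrArg (dT f v) (anchorT_core C v u)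

/-- The differential of a function on `TM`, split into its horizontal and vertical parts. -/
theorem dT_eq (f : TangentBundle 𝓘(ℝ, E) M → ℝ) (v : TangentBundle 𝓘(ℝ, E) M)
    (hf : MDifferentiableAt (𝓘(ℝ, E).prod 𝓘(ℝ, E)) 𝓘(ℝ, ℝ) f v)
    (X Z : TangentSpace 𝓘(ℝ, E) v.proj) :
    dT f v ((show E from X, show E from Z) : E × E) =
      mvfderiv 𝓘(ℝ, E) (fun y => f ⟨y, FiberBundle.extend E v.2 y⟩) v.proj X +
      deriv (fun r : ℝ => f ⟨v.proj, v.2 + r • Z⟩) 0 := by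
  refine (mfderiv_totalSpace_apply (Λ := f) hf X (show E from Z)).trans ?_
  have hZ : (fib E v.proj).symm (show E from Z) = Z := by
    rw [ContinuousLinearEquiv.symm_apply_eq, fib_tangentSpace]
  rw [hZ, ← fderiv_apply_one_eq_deriv, ← mfderiv_eq_fderiv]
  rfl

end Coanchor

/-! ### The Leibniz rules of a Courant algebroid, derived from the axioms, for local expansions. -/

section Leibniz

variable [FiniteDimensional ℝ E] [T2Space M]

theorem contMDiffOn_extend {x : M} (e : V x) :
    ContMDiffOn 𝓘(ℝ, E) (𝓘(ℝ, E).prod 𝓘(ℝ, F)) ∞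
      (fun y => (⟨y, FiberBundle.extend F e y⟩ : TotalSpace F V))
      (trivializationAt F V x).baseSet := by
  refine ((trivializationAt F V x).contMDiffOn_section_baseSet_iff (IB := 𝓘(ℝ, E))).2 ?_
  exact (contMDiffOn_const (c := fib F x e)).congr fun y hy => trivializationAt_snd_extend e hy

/-- A bump function supported in the trivializing set makes the constant-coordinate section global,
so that it can be an argument of the bracket. -/
theorem exists_section_eventuallyEq {x : M} (e : V x) :
    ∃ σ : Cₛ^∞⟮𝓘(ℝ, E); F, V⟯, ∀ᶠ y in 𝓝 x, σ y = FiberBundle.extend F e y := by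
  obtain ⟨χ, -, hχ⟩ := (SmoothBumpFunction.nhds_basis_tsupport (I := 𝓘(ℝ, E)) x).mem_iff.1
    ((trivializationAt F V x).open_baseSet.mem_nhds (mem_baseSet_trivializationAt F V x))
  have h := ContMDiffOn.smul_section_of_tsupport (I := 𝓘(ℝ, E)) (F := F)
    (s := FiberBundle.extend F e) (χ.contMDiff (I := 𝓘(ℝ, E))).contMDiffOn
    (trivializationAt F V x).open_baseSet hχ (contMDiffOn_extend (E := E) e)
  refine ⟨⟨fun y => χ y • FiberBundle.extend F e y, h⟩, ?_⟩
  filter_upwards [χ.eventuallyEq_one] with y hy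
  change χ y • FiberBundle.extend F e y = _
  rw [hy, Pi.one_apply, one_smul]

theorem exists_section_eq {x : M} (e : V x) : ∃ σ : Cₛ^∞⟮𝓘(ℝ, E); F, V⟯, σ x = e := by
  obtain ⟨σ, hσ⟩ := exists_section_eventuallyEq (E := E) (F := F) e
  exact ⟨σ, by simpa using hσ.self_of_nhds⟩

theorem mdifferentiableAt_pairing_coe (C : CourantAlgebroid E F V)
    (σ τ : Cₛ^∞⟮𝓘(ℝ, E); F, V⟯) (x : M) :
    MDifferentiableAt 𝓘(ℝ, E) 𝓘(ℝ, ℝ) (fun y => C.pairing y (σ y) (τ y)) x :=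
  mdifferentiableAt_pairing_section C (mdifferentiableAt_coe σ x) (mdifferentiableAt_coe τ x)

theorem mvfderiv_pairing_sum (C : CourantAlgebroid E F V) {ι : Type*} [Fintype ι]
    {σ τ : Cₛ^∞⟮𝓘(ℝ, E); F, V⟯} {σ' : ι → Cₛ^∞⟮𝓘(ℝ, E); F, V⟯} {φ : ι → M → ℝ} {x : M}
    (hφ : ∀ i, MDifferentiableAt 𝓘(ℝ, E) 𝓘(ℝ, ℝ) (φ i) x)
    (hσ : ∀ᶠ y in 𝓝 x, σ y = ∑ i, φ i y • σ' i y) (X : TangentSpace 𝓘(ℝ, E) x) :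
    mvfderiv 𝓘(ℝ, E) (fun y => C.pairing y (σ y) (τ y)) x X =
      ∑ i, (φ i x * mvfderiv 𝓘(ℝ, E) (fun y => C.pairing y (σ' i y) (τ y)) x X +
        mvfderiv 𝓘(ℝ, E) (φ i) x X * C.pairing x (σ' i x) (τ x)) := by
  refine mvfderiv_of_eventually_eq_sum_smul hφ
    (g := fun i y => C.pairing y (σ' i y) (τ y))
    (fun i => mdifferentiableAt_pairing_coe C (σ' i) τ x) ?_ X
  filter_upwards [hσ] with y hy
  simp [hy]

theorem pairing_bracket_eq (C : CourantAlgebroid E F V) (σ τ μ : Cₛ^∞⟮𝓘(ℝ, E); F, V⟯) (x : M) :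
    C.pairing x (C.bracket σ τ x) (μ x) =
      mvfderiv 𝓘(ℝ, E) (fun y => C.pairing y (τ y) (μ y)) x (C.anchor x (σ x)) -
        C.pairing x (τ x) (C.bracket σ μ x) :=
  eq_sub_of_add_eq (C.anchor_pairing σ τ μ x).symm

theorem pairing_bracket_swap (C : CourantAlgebroid E F V) (σ τ : Cₛ^∞⟮𝓘(ℝ, E); F, V⟯) (x : M)
    (u : V x) :
    C.pairing x (C.bracket σ τ x) u =
      mvfderiv 𝓘(ℝ, E) (fun y => C.pairing y (σ y) (τ y)) x (C.anchor x u) -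
        C.pairing x (C.bracket τ σ x) u := by
  have h := C.bracket_add_swap σ τ x u
  rw [map_add, LinearMap.add_apply] at h
  exact eq_sub_of_add_eq h

/-- The Leibniz rule in the second argument, for a local expansion. -/
theorem pairing_bracket_sum_right (C : CourantAlgebroid E F V) {ι : Type*} [Fintype ι]
    {σ τ : Cₛ^∞⟮𝓘(ℝ, E); F, V⟯} {τ' : ι → Cₛ^∞⟮𝓘(ℝ, E); F, V⟯} {ψ : ι → M → ℝ} {x : M}
    (hψ : ∀ i, MDifferentiableAt 𝓘(ℝ, E) 𝓘(ℝ, ℝ) (ψ i) x)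
    (hτ : ∀ᶠ y in 𝓝 x, τ y = ∑ i, ψ i y • τ' i y) (u : V x) :
    C.pairing x (C.bracket σ τ x) u =
      ∑ j, ψ j x * C.pairing x (C.bracket σ (τ' j) x) u +
        ∑ j, mvfderiv 𝓘(ℝ, E) (ψ j) x (C.anchor x (σ x)) * C.pairing x (τ' j x) u := by
  -- Extending `u` to a section `μ` allows the invariance of the metric to be used. The terms
  -- containing `⟦σ, μ⟧` match on the two sides, which leaves the derivatives of the coefficients.
  -- An expansion near `x` suffices, so no separate locality of the bracket is needed.
  obtain ⟨μ, rfl⟩ := exists_section_eq (E := E) (F := F) u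
  rw [pairing_bracket_eq, mvfderiv_pairing_sum C hψ hτ, hτ.self_of_nhds]
  simp only [pairing_bracket_eq, map_sum, map_smul, LinearMap.sum_apply, LinearMap.smul_apply,
    smul_eq_mul, mul_sub, Finset.sum_add_distrib, Finset.sum_sub_distrib]
  ring

/-- The Leibniz rule in the first argument, for a local expansion. -/
theorem pairing_bracket_sum_left (C : CourantAlgebroid E F V) {ι : Type*} [Fintype ι]
    {σ τ : Cₛ^∞⟮𝓘(ℝ, E); F, V⟯} {σ' : ι → Cₛ^∞⟮𝓘(ℝ, E); F, V⟯} {φ : ι → M → ℝ} {x : M}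
    (hφ : ∀ i, MDifferentiableAt 𝓘(ℝ, E) 𝓘(ℝ, ℝ) (φ i) x)
    (hσ : ∀ᶠ y in 𝓝 x, σ y = ∑ i, φ i y • σ' i y) (u : V x) :
    C.pairing x (C.bracket σ τ x) u =
      ∑ i, φ i x * C.pairing x (C.bracket (σ' i) τ x) u -
        ∑ i, mvfderiv 𝓘(ℝ, E) (φ i) x (C.anchor x (τ x)) * C.pairing x (σ' i x) u +
        ∑ i, mvfderiv 𝓘(ℝ, E) (φ i) x (C.anchor x u) * C.pairing x (σ' i x) (τ x) := by
  -- Exchanging the arguments reduces to the rule on the right. The symmetric part `a^* d⟨σ, τ⟩` of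
  -- the bracket produces the extra sum with `a(u)`.
  rw [pairing_bracket_swap, mvfderiv_pairing_sum C hφ hσ, pairing_bracket_sum_right C hφ hσ]
  simp only [pairing_bracket_swap C (σ' _) τ, mul_sub, Finset.sum_add_distrib,
    Finset.sum_sub_distrib]
  ring

/-- The Leibniz rules in both arguments, for local expansions. -/
theorem pairing_bracket_sum_sum (C : CourantAlgebroid E F V) {ι κ : Type*} [Fintype ι] [Fintype κ]
    {σ τ : Cₛ^∞⟮𝓘(ℝ, E); F, V⟯} {σ' : ι → Cₛ^∞⟮𝓘(ℝ, E); F, V⟯} {φ : ι → M → ℝ}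
    {τ' : κ → Cₛ^∞⟮𝓘(ℝ, E); F, V⟯} {ψ : κ → M → ℝ} {x : M}
    (hφ : ∀ i, MDifferentiableAt 𝓘(ℝ, E) 𝓘(ℝ, ℝ) (φ i) x)
    (hσ : ∀ᶠ y in 𝓝 x, σ y = ∑ i, φ i y • σ' i y)
    (hψ : ∀ i, MDifferentiableAt 𝓘(ℝ, E) 𝓘(ℝ, ℝ) (ψ i) x)
    (hτ : ∀ᶠ y in 𝓝 x, τ y = ∑ i, ψ i y • τ' i y) (u : V x) :
    C.pairing x (C.bracket σ τ x) u =
      ∑ i, ∑ j, φ i x * ψ j x * C.pairing x (C.bracket (σ' i) (τ' j) x) u +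
        ∑ j, mvfderiv 𝓘(ℝ, E) (ψ j) x (C.anchor x (σ x)) * C.pairing x (τ' j x) u -
        ∑ i, mvfderiv 𝓘(ℝ, E) (φ i) x (C.anchor x (τ x)) * C.pairing x (σ' i x) u +
        ∑ i, mvfderiv 𝓘(ℝ, E) (φ i) x (C.anchor x u) * C.pairing x (σ' i x) (τ x) := by
  rw [pairing_bracket_sum_left C hφ hσ]
  congr 2
  simp only [pairing_bracket_sum_right C hψ hτ, mul_add, Finset.sum_add_distrib, Finset.mul_sum,
    mul_assoc]
  congr 1
  rw [Finset.sum_comm]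
  refine Finset.sum_congr rfl fun j _ => ?_
  rw [hσ.self_of_nhds]
  simp only [map_sum, map_smul, smul_eq_mul, Finset.sum_mul, mul_assoc]

end Leibniz

/-! ### Smooth sections of `T𝔼 → TM` as local combinations of tangent lifts and core sections. -/

section Expansions

/-- The fibre coordinate of the preferred trivialization at `x₀`. -/
def fibreCoord (F : Type*) [NormedAddCommGroup F] [NormedSpace ℝ F]
    {V : M → Type*} [∀ x, AddCommGroup (V x)] [∀ x, Module ℝ (V x)] [∀ x, TopologicalSpace (V x)]
    [TopologicalSpace (TotalSpace F V)] [FiberBundle F V] [VectorBundle ℝ F V] (x₀ : M)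
    (e : TotalSpace F V) : F := (trivializationAt F V x₀ e).2

theorem contMDiffOn_fibreCoord (x₀ : M) :
    ContMDiffOn (𝓘(ℝ, E).prod 𝓘(ℝ, F)) 𝓘(ℝ, F) ∞ (fibreCoord F (V := V) x₀)
      (trivializationAt F V x₀).source :=
  fun e he => (((trivializationAt F V x₀).contMDiffOn (IB := 𝓘(ℝ, E)) (n := ∞)) e he).snd

theorem contMDiffAt_fibreCoord {x₀ y : M} (hy : y ∈ (trivializationAt F V x₀).baseSet) (e : V y) :
    ContMDiffAt (𝓘(ℝ, E).prod 𝓘(ℝ, F)) 𝓘(ℝ, F) ∞ (fibreCoord F (V := V) x₀) ⟨y, e⟩ :=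
  (contMDiffOn_fibreCoord x₀).contMDiffAt
    ((trivializationAt F V x₀).open_source.mem_nhds ((Trivialization.mem_source _).2 hy))

theorem isLinearMap_fibreCoord {x₀ y : M} (hy : y ∈ (trivializationAt F V x₀).baseSet) :
    IsLinearMap ℝ (fun e : V y => fibreCoord F x₀ ⟨y, e⟩) :=
  (trivializationAt F V x₀).linear ℝ hy

theorem fibreCoord_injective {x₀ y : M} (hy : y ∈ (trivializationAt F V x₀).baseSet) :
    Function.Injective (fun e : V y => fibreCoord F x₀ ⟨y, e⟩) :=
  ((trivializationAt F V x₀).continuousLinearEquivAt ℝ y hy).injective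

/-- The coordinates of a vector tangent to `𝔼`, in the fibre direction. -/
def tangentCoord (F : Type*) [NormedAddCommGroup F] [NormedSpace ℝ F]
    {V : M → Type*} [∀ x, AddCommGroup (V x)] [∀ x, Module ℝ (V x)] [∀ x, TopologicalSpace (V x)]
    [TopologicalSpace (TotalSpace F V)] [FiberBundle F V] [VectorBundle ℝ F V] (x₀ : M)
    (ξ : TangentBundle (𝓘(ℝ, E).prod 𝓘(ℝ, F)) (TotalSpace F V)) : F :=
  mfderiv (𝓘(ℝ, E).prod 𝓘(ℝ, F)) 𝓘(ℝ, F) (fibreCoord F (V := V) x₀) ξ.proj ξ.2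

/-- The fibre component of `TFib` refers to a chart that changes with the base point. The
coordinates of a fixed trivialization at `x₀` form a smooth function on `T𝔼`, being the fibre part
of a tangent map. -/
theorem contMDiffAt_tangentCoord {x₀ : M}
    {ξ : TangentBundle (𝓘(ℝ, E).prod 𝓘(ℝ, F)) (TotalSpace F V)}
    (hξ : ξ.proj.proj ∈ (trivializationAt F V x₀).baseSet) :
    ContMDiffAt ((𝓘(ℝ, E).prod 𝓘(ℝ, F)).prod 𝓘(ℝ, E × F)) 𝓘(ℝ, F) ∞
      (tangentCoord (E := E) F (V := V) x₀) ξ := by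
  have ho := (trivializationAt F V x₀).open_source
  have hmem : ξ.proj ∈ (trivializationAt F V x₀).source := (Trivialization.mem_source _).2 hξ
  have h := (contMDiffOn_fibreCoord (E := E) (F := F) (V := V) x₀).contMDiffOn_tangentMapWithin
    (m := ∞) le_rfl ho.uniqueMDiffOn
  have hn : (TotalSpace.proj ⁻¹' (trivializationAt F V x₀).source :
      Set (TangentBundle (𝓘(ℝ, E).prod 𝓘(ℝ, F)) (TotalSpace F V))) ∈ 𝓝 ξ :=
    (FiberBundle.continuous_proj (E × F) _).continuousAt.preimage_mem_nhds (ho.mem_nhds hmem)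
  have h2 := (contMDiff_snd_tangentBundle_modelSpace F 𝓘(ℝ, F)).contMDiffAt.comp ξ
    (h.contMDiffAt hn)
  refine h2.congr_of_eventuallyEq ?_
  filter_upwards [hn] with ζ hζ
  change _ = (mfderivWithin _ _ _ _ _ : _) ζ.2
  rw [mfderivWithin_of_isOpen ho hζ]
  rfl

theorem isLinearMap_tangentCoord {x₀ : M} {v : TangentBundle 𝓘(ℝ, E) M}
    (hv : v.proj ∈ (trivializationAt F V x₀).baseSet) :
    IsLinearMap ℝ (fun p : TFib F V v => tangentCoord F x₀ (toTE v p)) := by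
  refine isLinearMap_mfderiv_fibrewiseLinear (E := E) (x := v.proj)
    (fun e => (contMDiffAt_fibreCoord hv e).mdifferentiableAt (by simp)) ?_ v.2
  filter_upwards [(trivializationAt F V x₀).open_baseSet.mem_nhds hv] with y hy
    using isLinearMap_fibreCoord hy

theorem tangentCoord_vertical {x₀ : M} {v : TangentBundle 𝓘(ℝ, E) M}
    (hv : v.proj ∈ (trivializationAt F V x₀).baseSet) (w : F) :
    tangentCoord F x₀ (toTE v ((0, w) : TFib F V v)) =
      fibreCoord F x₀ ⟨v.proj, ((fib F v.proj).symm w : V v.proj)⟩ := by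
  have h0 := (contMDiffAt_fibreCoord (E := E) hv (0 : V v.proj)).mdifferentiableAt (by simp)
  have hl := isLinearMap_fibreCoord hv
  have h1 := mfderiv_fibrewiseLinear_apply (E := E) h0 hl v.2 w
  have h2 := mfderiv_fibrewiseLinear_apply (E := E) h0 hl v.2 0
  have h3 : tangentCoord F x₀ (toTE v ((0, 0) : TFib F V v)) = 0 :=
    (isLinearMap_tangentCoord hv).map_zero
  have h4 : fibreCoord F x₀ ⟨v.proj, ((fib F v.proj).symm 0 : V v.proj)⟩ = 0 := by
    rw [map_zero]; exact hl.map_zero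
  have h5 := (h2.symm.trans h3)
  rw [h4, add_zero] at h5
  exact h1.trans (by rw [h5, zero_add])

theorem tangentCoord_liftT {x₀ : M} {v : TangentBundle 𝓘(ℝ, E) M}
    (hv : v.proj ∈ (trivializationAt F V x₀).baseSet) (σ : Cₛ^∞⟮𝓘(ℝ, E); F, V⟯) :
    tangentCoord F x₀ (toTE v (liftT σ v)) =
      mvfderiv 𝓘(ℝ, E) (fun y => fibreCoord F x₀ ⟨y, σ y⟩) v.proj v.2 := by
  have h0 := (contMDiffAt_fibreCoord (E := E) hv (σ v.proj)).mdifferentiableAt (by simp)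
  have h1 := HasMFDerivAt.comp (x := v.proj) h0.hasMFDerivAt
    (hasMFDerivAt_section (mdifferentiableAt_coe σ v.proj))
  have h2 := congrArg (fun T : E →L[ℝ] F => T v.2) h1.mfderiv
  refine Eq.trans ?_ h2.symm
  rw [liftT_eq]
  rfl

theorem eq_of_coord_eq {x₀ : M} {v : TangentBundle 𝓘(ℝ, E) M}
    (hv : v.proj ∈ (trivializationAt F V x₀).baseSet) {p q : TFib F V v}
    (h1 : fibreCoord F x₀ ⟨v.proj, p.1⟩ = fibreCoord F x₀ ⟨v.proj, q.1⟩)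
    (h2 : tangentCoord F x₀ (toTE v p) = tangentCoord F x₀ (toTE v q)) : p = q := by
  have h3 : p.1 = q.1 := fibreCoord_injective hv h1
  have h4 := (isLinearMap_tangentCoord hv).map_sub p q
  have h5 : p - q = (0, p.2 - q.2) := Prod.ext (sub_eq_zero.2 h3) rfl
  rw [h2, sub_self, h5, tangentCoord_vertical hv] at h4
  have h6 := fibreCoord_injective hv (h4.trans (isLinearMap_fibreCoord hv).map_zero.symm)
  rw [map_eq_zero_iff _ (fib F v.proj).symm.injective] at h6
  exact Prod.ext h3 (sub_eq_zero.1 h6)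

variable [FiniteDimensional ℝ E] [T2Space M] [FiniteDimensional ℝ F]

/-- Take sections `σ i` whose coordinates near `x₀` are the constant basis vectors. Their tangent
lifts have zero tangent coordinate and their core sections have zero base coordinate, so the
coefficients are the two kinds of coordinates of `s` separately. -/
theorem exists_expansion {s : ∀ v : TangentBundle 𝓘(ℝ, E) M, TFib F V v}
    (hs : IsSmoothSection s) (v : TangentBundle 𝓘(ℝ, E) M) : Nonempty (Expansion s v) := by
  set b := Module.finBasis ℝ F
  set x₀ := v.proj
  choose σ hσ using fun i => exists_section_eventuallyEq (E := E) (F := F)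
      ((fib F (V := V) x₀).symm (b i))
  have hb := (trivializationAt F V x₀).open_baseSet.mem_nhds (mem_baseSet_trivializationAt F V x₀)
  have hcoord : ∀ i, ∀ᶠ y in 𝓝 x₀, fibreCoord F x₀ ⟨y, σ i y⟩ = b i := fun i => by
    filter_upwards [hσ i, hb] with y hy hy'
    rw [hy]
    exact (trivializationAt_snd_extend _ hy').trans ((fib F x₀).apply_symm_apply _)
  let c : Fin (Module.finrank ℝ F) → F →L[ℝ] ℝ := fun i => (b.coord i).toContinuousLinearMap
  have hc : ∀ w : F, ∑ i, c i w • b i = w := fun w => b.sum_repr w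
  have hs0 : ContMDiffAt (𝓘(ℝ, E).prod 𝓘(ℝ, E)) ((𝓘(ℝ, E).prod 𝓘(ℝ, F)).prod 𝓘(ℝ, E × F)) ∞
    (fun v => toTE v (s v)) v := hs v
  refine ⟨⟨_, σ, fun i v' => c i (fibreCoord F x₀ ⟨v'.proj, (s v').1⟩),
    fun i v' => c i (tangentCoord F x₀ (toTE v' (s v'))), fun i => ?_, fun i => ?_, ?_⟩⟩
  · have h1 : ContMDiffAt (𝓘(ℝ, E).prod 𝓘(ℝ, E)) (𝓘(ℝ, E).prod 𝓘(ℝ, F)) ∞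
        (fun v => (toTE v (s v)).proj) v := (contMDiff_proj _).contMDiffAt.comp v hs0
    have h2 := (contMDiffAt_fibreCoord (E := E) (mem_baseSet_trivializationAt F V x₀)
      (s v).1).comp v h1
    exact (c i).contMDiff.contMDiffAt.comp v h2
  · have h2 := (contMDiffAt_tangentCoord (x₀ := x₀) (ξ := toTE v (s v))
      (mem_baseSet_trivializationAt F V x₀)).comp v hs0
    exact (c i).contMDiff.contMDiffAt.comp v h2
  · have hall : ∀ᶠ y in 𝓝 x₀, y ∈ (trivializationAt F V x₀).baseSet ∧
        ∀ i, ∀ᶠ z in 𝓝 y, fibreCoord F x₀ ⟨z, σ i z⟩ = b i :=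
      Eventually.and hb (eventually_all.2 fun i => (hcoord i).eventually_nhds)
    have hπ : Tendsto (TotalSpace.proj : TangentBundle 𝓘(ℝ, E) M → M) (𝓝 v) (𝓝 x₀) :=
      (FiberBundle.continuous_proj E (TangentSpace 𝓘(ℝ, E))).continuousAt
    filter_upwards [hπ.eventually hall] with v' hv'
    obtain ⟨hy, hi⟩ := hv'
    have hT : ∀ i, tangentCoord F x₀ (toTE v' (liftT (σ i) v')) = 0 := fun i => by
      rw [tangentCoord_liftT hy, mvfderiv_congr (hi i), mvfderiv_const]; rfl
    have hC : ∀ i, tangentCoord F x₀ (toTE v' (liftC (σ i) v')) = b i := fun i => by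
      rw [liftC_eq, tangentCoord_vertical hy, ContinuousLinearEquiv.symm_apply_apply]
      exact (hi i).self_of_nhds
    refine eq_of_coord_eq hy ?_ ?_
    · have hL := isLinearMap_fibreCoord (F := F) (V := V) hy
      set T := hL.mk' _ with hTdef
      have key : ∀ e, fibreCoord F x₀ ⟨v'.proj, e⟩ = T e := fun e => rfl
      have h1 : ∀ i, T (liftT (σ i) v').1 = b i := fun i => (hi i).self_of_nhds
      have h2 : ∀ i, T (liftC (σ i) v').1 = 0 := fun i => by rw [liftC_eq]; exact T.map_zero
      rw [key, key]
      simp only [Prod.fst_sum, Prod.fst_add, Prod.smul_fst, map_sum, map_add, map_smul, h1, h2,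
        smul_zero, add_zero]
      exact (hc _).symm
    · have hL := isLinearMap_tangentCoord (F := F) (V := V) hy
      set T := hL.mk' _ with hTdef
      have key : ∀ e, tangentCoord F x₀ (toTE v' e) = T e := fun e => rfl
      simp only [key] at hT hC ⊢
      simp only [map_sum, map_add, map_smul, hT, hC, smul_zero, zero_add]
      exact (hc _).symm

end Expansions

/-! ### Linear algebra of the two vector bundle structures of `L`. -/

section DoubleSubbundle

/-- Rank-nullity for the projection to `U`; the hypothesis `hk` says that the two kernels coincide.
-/
theorem finrank_map_fst_eq {U G : Type*} [AddCommGroup U] [Module ℝ U] [FiniteDimensional ℝ U]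
    [AddCommGroup G] [Module ℝ G] [FiniteDimensional ℝ G] {A B : Submodule ℝ (U × G)}
    (hr : Module.finrank ℝ A = Module.finrank ℝ B)
    (hk : ∀ w : G, ((0, w) : U × G) ∈ A ↔ ((0, w) : U × G) ∈ B) :
    Module.finrank ℝ (A.map (LinearMap.fst ℝ U G)) =
      Module.finrank ℝ (B.map (LinearMap.fst ℝ U G)) := by
  have key : ∀ D : Submodule ℝ (U × G), Module.finrank ℝ (D.map (LinearMap.fst ℝ U G)) +
      Module.finrank ℝ ↥(D ⊓ LinearMap.ker (LinearMap.fst ℝ U G)) = Module.finrank ℝ D := by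
    intro D
    have h := ((LinearMap.fst ℝ U G).domRestrict D).finrank_range_add_finrank_ker
    have h2 : (LinearMap.ker ((LinearMap.fst ℝ U G).domRestrict D)).map D.subtype =
        D ⊓ LinearMap.ker (LinearMap.fst ℝ U G) := by
      ext p
      simp only [Submodule.mem_map, LinearMap.mem_ker, Submodule.mem_inf]
      exact ⟨fun ⟨a, ha, hp⟩ => hp ▸ ⟨a.2, ha⟩, fun ⟨ha, hp⟩ => ⟨⟨p, ha⟩, hp, rfl⟩⟩
    rw [← Submodule.finrank_map_subtype_eq D, h2, LinearMap.range_domRestrict] at h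
    exact h
  have h3 : A ⊓ LinearMap.ker (LinearMap.fst ℝ U G) = B ⊓ LinearMap.ker (LinearMap.fst ℝ U G) := by
    ext ⟨a, w⟩
    simp only [Submodule.mem_inf, LinearMap.mem_ker, LinearMap.fst_apply]
    constructor
    · rintro ⟨h, rfl⟩; exact ⟨(hk w).1 h, rfl⟩
    · rintro ⟨h, rfl⟩; exact ⟨(hk w).2 h, rfl⟩
  have hA := key A
  have hB := key B
  rw [h3] at hA
  omega

variable {L : Set (TangentBundle (𝓘(ℝ, E).prod 𝓘(ℝ, F)) (TotalSpace F V))}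
  {W : ∀ x, Submodule ℝ (V x)}

namespace IsDoubleVectorSubbundle

theorem zero_mem (hL : IsDoubleVectorSubbundle (E := E) L W) (v : TangentBundle 𝓘(ℝ, E) M) : toTE v
    (0 : TFib F V v) ∈ L := by
  obtain ⟨D, hD, -⟩ := hL.over_TM
  exact (hD v 0).2 (D v).zero_mem

theorem sub_mem (hL : IsDoubleVectorSubbundle (E := E) L W) {v : TangentBundle 𝓘(ℝ, E) M}
    {p q : TFib F V v} (hp : toTE v p ∈ L) (hq : toTE v q ∈ L) :
    toTE v (p - q) ∈ L := by
  obtain ⟨D, hD, -⟩ := hL.over_TM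
  exact (hD v _).2 ((D v).sub_mem ((hD v p).1 hp) ((hD v q).1 hq))

theorem fst_mem (hL : IsDoubleVectorSubbundle (E := E) L W) {v : TangentBundle 𝓘(ℝ, E) M}
    {p : TFib F V v} (hp : toTE v p ∈ L) :
    p.1 ∈ W v.proj := by
  obtain ⟨D, hD, -⟩ := hL.over_side
  exact ((hD _).1 hp).1

theorem side_zero_mem (hL : IsDoubleVectorSubbundle (E := E) L W) {x : M} {e : V x} (he : e ∈ W x) :
    toTE (⟨x, 0⟩ : TangentBundle 𝓘(ℝ, E) M) ((e, 0) : V x × F) ∈ L := by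
  obtain ⟨D, hD, -⟩ := hL.over_side
  exact (hD _).2 ⟨he, (D ⟨x, e⟩).zero_mem⟩

theorem side_add_mem (hL : IsDoubleVectorSubbundle (E := E) L W) {x : M} {e : V x}
    {X Y : TangentSpace 𝓘(ℝ, E) x} {w z : F}
    (hX : toTE (⟨x, X⟩ : TangentBundle 𝓘(ℝ, E) M) ((e, w) : V x × F) ∈ L)
    (hY : toTE (⟨x, Y⟩ : TangentBundle 𝓘(ℝ, E) M) ((e, z) : V x × F) ∈ L) :
    toTE (⟨x, X + Y⟩ : TangentBundle 𝓘(ℝ, E) M) ((e, w + z) : V x × F) ∈ L := by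
  obtain ⟨D, hD, -⟩ := hL.over_side
  exact (hD _).2 ⟨((hD _).1 hX).1, (D ⟨x, e⟩).add_mem ((hD _).1 hX).2 ((hD _).1 hY).2⟩

theorem side_smul_mem (hL : IsDoubleVectorSubbundle (E := E) L W) {x : M} {e : V x}
    {X : TangentSpace 𝓘(ℝ, E) x} {w : F} (r : ℝ)
    (hX : toTE (⟨x, X⟩ : TangentBundle 𝓘(ℝ, E) M) ((e, w) : V x × F) ∈ L) :
    toTE (⟨x, r • X⟩ : TangentBundle 𝓘(ℝ, E) M) ((e, r • w) : V x × F) ∈ L := by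
  obtain ⟨D, hD, -⟩ := hL.over_side
  exact (hD _).2 ⟨((hD _).1 hX).1, (D ⟨x, e⟩).smul_mem r ((hD _).1 hX).2⟩

/-- Over the zero of `𝔼_x`, every `Y ∈ T_xM` is covered by a zero element of `L → TM`. Adding such
elements in the structure over `W` changes the base vector and not the core part. -/
theorem core_mem_iff (hL : IsDoubleVectorSubbundle (E := E) L W) {x : M}
    (X : TangentSpace 𝓘(ℝ, E) x) (w : F) :
    toTE (⟨x, X⟩ : TangentBundle 𝓘(ℝ, E) M) ((0, w) : V x × F) ∈ L ↔
      toTE (⟨x, 0⟩ : TangentBundle 𝓘(ℝ, E) M) ((0, w) : V x × F) ∈ L := by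
  have h0 : ∀ Y, toTE (⟨x, Y⟩ : TangentBundle 𝓘(ℝ, E) M) ((0, 0) : V x × F) ∈ L :=
    fun Y => hL.zero_mem ⟨x, Y⟩
  constructor
  · intro h
    have := hL.side_add_mem h (h0 (-X))
    rwa [add_neg_cancel, add_zero] at this
  · intro h
    have := hL.side_add_mem h (h0 X)
    rwa [zero_add, add_zero] at this

/-- Over the zero vector the projection of `L` is all of `W_x`. Over a vector near zero the fibre of
`L` has the same rank and the same core part, so its projection has the same dimension and fills
`W_x` too. Scaling in the structure over `W` reaches every `X`. -/
theorem exists_mem [FiniteDimensional ℝ F] (hL : IsDoubleVectorSubbundle (E := E) L W) {x : M}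
    (X : TangentSpace 𝓘(ℝ, E) x) {e : V x} (he : e ∈ W x) :
    ∃ w : F, toTE (⟨x, X⟩ : TangentBundle 𝓘(ℝ, E) M) ((e, w) : V x × F) ∈ L := by
  have := finiteDimensional_fibre F (V := V) x
  obtain ⟨D, hD, hfr⟩ := hL.over_TM
  obtain ⟨U, hU, h0, n, s, -, hs⟩ := hfr (⟨x, 0⟩ : TangentBundle 𝓘(ℝ, E) M) (mem_univ _)
  have hrank : ∀ Y : TangentSpace 𝓘(ℝ, E) x, (⟨x, Y⟩ : TangentBundle 𝓘(ℝ, E) M) ∈ U →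
      Module.finrank ℝ (D ⟨x, Y⟩) = n := by
    intro Y hY
    obtain ⟨h1, h2⟩ := hs _ ⟨hY, mem_univ _⟩
    rw [← h2, finrank_span_eq_card h1, Fintype.card_fin]
  have hcont : ContinuousAt (fun r : ℝ => (⟨x, (0 : TangentSpace 𝓘(ℝ, E) x) + r • X⟩ :
      TangentBundle 𝓘(ℝ, E) M)) 0 :=
    (hasMFDerivAt_line (E := E) (F := E) (V := TangentSpace 𝓘(ℝ, E)) 0 X 0).continuousAt
  have hev : ∀ᶠ r : ℝ in 𝓝 0, (⟨x, (0 : TangentSpace 𝓘(ℝ, E) x) + r • X⟩ :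
      TangentBundle 𝓘(ℝ, E) M) ∈ U := hcont.preimage_mem_nhds (hU.mem_nhds (by simpa using h0))
  -- A nonzero `r` so small that `r • X` lies in the domain of the frame around the zero vector.
  obtain ⟨r, hr, hr0⟩ := ((hev.filter_mono nhdsWithin_le_nhds).and
    (self_mem_nhdsWithin (a := (0 : ℝ)) (s := {0}ᶜ))).exists
  rw [zero_add] at hr
  have hfin := finrank_map_fst_eq (U := V x) (G := F) (A := D ⟨x, r • X⟩) (B := D ⟨x, 0⟩)
    ((hrank _ hr).trans (hrank _ h0).symm) fun w => by
      rw [← hD ⟨x, r • X⟩ ((0, w) : V x × F), ← hD ⟨x, 0⟩ ((0, w) : V x × F)]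
      exact hL.core_mem_iff _ w
  have h0W : (D ⟨x, 0⟩).map (LinearMap.fst ℝ (V x) F) = W x := by
    ext a
    simp only [Submodule.mem_map]
    constructor
    · rintro ⟨p, hp, rfl⟩
      exact hL.fst_mem ((hD ⟨x, 0⟩ p).2 hp)
    · intro ha
      exact ⟨(a, 0), (hD ⟨x, 0⟩ _).1 (hL.side_zero_mem ha), rfl⟩
  have hle : (D ⟨x, r • X⟩).map (LinearMap.fst ℝ (V x) F) ≤ W x := by
    rintro a ⟨p, hp, rfl⟩
    exact hL.fst_mem ((hD ⟨x, r • X⟩ p).2 hp)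
  rw [h0W] at hfin
  have heq := Submodule.eq_of_le_of_finrank_eq hle hfin
  rw [← heq] at he
  obtain ⟨⟨a, w⟩, hp, rfl⟩ := he
  have h1 := hL.side_smul_mem r⁻¹ ((hD ⟨x, r • X⟩ _).2 hp)
  rw [smul_smul, inv_mul_cancel₀ hr0, one_smul] at h1
  exact ⟨_, h1⟩

end IsDoubleVectorSubbundle

namespace IsVBDirac

variable {C : CourantAlgebroid E F V} [FiniteDimensional ℝ F]

/-- Lift `e` to an element of `L` over the same `X`. Isotropy, together with the fact that a
vertical vector pairs only with projections, shows that the core part of `L` lies in `W^⊥`. -/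
theorem pairing_eq_zero (hL : IsVBDirac C L W) {x : M} {X : TangentSpace 𝓘(ℝ, E) x} {w : F}
    (h : toTE (⟨x, X⟩ : TangentBundle 𝓘(ℝ, E) M) ((0, w) : V x × F) ∈ L) {e : V x} (he : e ∈ W x) :
    C.pairing x ((fib F x).symm w) e = 0 := by
  obtain ⟨z, hz⟩ := hL.toIsDoubleVectorSubbundle.exists_mem X he
  rw [← pairingT_vertical C ⟨x, X⟩ w ((e, z) : V x × F)]
  exact (hL.lagrangian _ _).1 h _ hz

theorem pairing_congr (hL : IsVBDirac C L W) {x : M} {X : TangentSpace 𝓘(ℝ, E) x} {e : V x}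
    {w z : F}
    (hw : toTE (⟨x, X⟩ : TangentBundle 𝓘(ℝ, E) M) ((e, w) : V x × F) ∈ L)
    (hz : toTE (⟨x, X⟩ : TangentBundle 𝓘(ℝ, E) M) ((e, z) : V x × F) ∈ L) {e' : V x}
    (he : e' ∈ W x) :
    C.pairing x ((fib F x).symm w) e' = C.pairing x ((fib F x).symm z) e' := by
  have h := hL.toIsDoubleVectorSubbundle.sub_mem hw hz
  have h2 := hL.pairing_eq_zero (w := w - z) (by simpa using h) he
  rwa [map_sub, map_sub, LinearMap.sub_apply, sub_eq_zero] at h2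

/-- The core element chosen in `quotientMap` is determined only up to the core part of `L`, which
`W` does not see. So any element of `L` over `X` and `σ x` may be used to compute `∇_X σ`. -/
theorem nabla_eq (hL : IsVBDirac C L W) (σ : sections E F W) {x : M} {X : TangentSpace 𝓘(ℝ, E) x}
    {w : F}
    (hw : toTE (⟨x, X⟩ : TangentBundle 𝓘(ℝ, E) M) ((σ.1 x, w) : V x × F) ∈ L) (e : W x) :
    nabla C L W σ x X e =
      C.pairing x ((fib F x).symm (sectionDeriv (E := E) (F := F) σ.1 x X - w)) e := by
  have key : ∀ c : V x, (liftT σ.1 ⟨x, X⟩ - core ⟨x, X⟩ c : V x × F) =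
      (σ.1 x, sectionDeriv (E := E) (F := F) σ.1 x X - fib F x c) := fun c => by
    rw [liftT_eq, core_eq]
    exact Prod.ext (sub_zero _) rfl
  have hex : ∃ c : V x, toTE (⟨x, X⟩ : TangentBundle 𝓘(ℝ, E) M)
      (liftT σ.1 ⟨x, X⟩ - core ⟨x, X⟩ c) ∈ L := by
    refine ⟨(fib F x).symm (sectionDeriv (E := E) (F := F) σ.1 x X - w), ?_⟩
    rw [key, ContinuousLinearEquiv.apply_symm_apply, sub_sub_cancel]
    exact hw
  have hspec := Classical.epsilon_spec hex
  rw [key] at hspec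
  have h := hL.pairing_congr hspec hw e.2
  rw [map_sub, ContinuousLinearEquiv.symm_apply_apply, map_sub, LinearMap.sub_apply] at h
  rw [map_sub, map_sub, LinearMap.sub_apply, ← h]
  exact (sub_sub_cancel _ _).symm

/-- Elements of `L` over the same point of `W` add and scale together with their base vectors, and
so does the derivative of `σ`. This linearity is what `coanchor_spec` requires. -/
theorem isLinearMap_nabla (hL : IsVBDirac C L W) (σ : sections E F W) (x : M) (e : W x) :
    IsLinearMap ℝ (fun X => nabla C L W σ x X e) := by
  constructor
  · intro X Y
    obtain ⟨w, hw⟩ := hL.toIsDoubleVectorSubbundle.exists_mem X (σ.2 x)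
    obtain ⟨z, hz⟩ := hL.toIsDoubleVectorSubbundle.exists_mem Y (σ.2 x)
    rw [hL.nabla_eq σ hw, hL.nabla_eq σ hz,
      hL.nabla_eq σ (hL.toIsDoubleVectorSubbundle.side_add_mem hw hz), ← LinearMap.add_apply,
      ← map_add, ← map_add]
    congr 3
    rw [ContinuousLinearMap.map_add]
    exact add_sub_add_comm _ _ _ _
  · intro r X
    obtain ⟨w, hw⟩ := hL.toIsDoubleVectorSubbundle.exists_mem X (σ.2 x)
    rw [hL.nabla_eq σ hw,
      hL.nabla_eq σ (hL.toIsDoubleVectorSubbundle.side_smul_mem r hw), ← LinearMap.smul_apply,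
      ← map_smul, ← map_smul]
    congr 3
    rw [ContinuousLinearMap.map_smul]
    exact (smul_sub r _ _).symm

/-- Along a fibre of `TM`, the sections of `L` over a section of `W` are affine modulo the core. -/
theorem pairing_affine (hL : IsVBDirac C L W) {x : M} {e e' : V x} (he' : e' ∈ W x)
    {S : TangentSpace 𝓘(ℝ, E) x → F}
    (hS : ∀ X, toTE (⟨x, X⟩ : TangentBundle 𝓘(ℝ, E) M) ((e, S X) : V x × F) ∈ L)
    (X Z : TangentSpace 𝓘(ℝ, E) x) (r : ℝ) :
    C.pairing x ((fib F x).symm (S (X + r • Z))) e' =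
      C.pairing x ((fib F x).symm (S X)) e' + r * C.pairing x ((fib F x).symm (S Z)) e' := by
  rw [hL.pairing_congr (hS (X + r • Z)) (hL.toIsDoubleVectorSubbundle.side_add_mem (hS X)
    (hL.toIsDoubleVectorSubbundle.side_smul_mem r (hS Z))) he', map_add, map_add, map_smul,
    map_smul]
  rfl

end IsVBDirac

end DoubleSubbundle

/-! ### Coefficients of expansions of projectable sections, and the correction term. -/

section SideBracket

theorem differentiableAt_line {f : TangentBundle 𝓘(ℝ, E) M → ℝ} {x : M}
    {X : TangentSpace 𝓘(ℝ, E) x}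
    (hf : MDifferentiableAt (𝓘(ℝ, E).prod 𝓘(ℝ, E)) 𝓘(ℝ, ℝ) f ⟨x, X⟩)
    (Z : TangentSpace 𝓘(ℝ, E) x) :
    DifferentiableAt ℝ (fun r : ℝ => f ⟨x, X + r • Z⟩) 0 := by
  rw [← mdifferentiableAt_iff_differentiableAt]
  refine MDifferentiableAt.comp (x := (0 : ℝ)) (g := f)
    (f := fun r : ℝ => (⟨x, X + r • Z⟩ : TangentBundle 𝓘(ℝ, E) M)) ?_
    (hasMFDerivAt_line (E := E) (F := E) (V := TangentSpace 𝓘(ℝ, E)) X Z 0).mdifferentiableAt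
  simpa using hf

theorem hasDerivAt_line {f : TangentBundle 𝓘(ℝ, E) M → ℝ} {x : M}
    {X : TangentSpace 𝓘(ℝ, E) x}
    (hf : MDifferentiableAt (𝓘(ℝ, E).prod 𝓘(ℝ, E)) 𝓘(ℝ, ℝ) f ⟨x, X⟩)
    (Z : TangentSpace 𝓘(ℝ, E) x) :
    HasDerivAt (fun r : ℝ => f ⟨x, X + r • Z⟩)
      (dT f ⟨x, X⟩ (((0 : E), show E from Z) : E × E)) 0 := by
  have h := dT_eq f ⟨x, X⟩ hf 0 Z
  rw [map_zero, zero_add] at h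
  exact (differentiableAt_line hf Z).hasDerivAt.congr_deriv h.symm

theorem tendsto_line {x : M} (X Z : TangentSpace 𝓘(ℝ, E) x) :
    Tendsto (fun r : ℝ => (⟨x, X + r • Z⟩ : TangentBundle 𝓘(ℝ, E) M)) (𝓝 0) (𝓝 ⟨x, X⟩) := by
  have h := (hasMFDerivAt_line (E := E) (F := E) (V := TangentSpace 𝓘(ℝ, E)) X Z 0).continuousAt
  simpa [ContinuousAt] using h

theorem tendsto_extend {x : M} (X : TangentSpace 𝓘(ℝ, E) x) :
    Tendsto (fun y => (⟨y, FiberBundle.extend E X y⟩ : TangentBundle 𝓘(ℝ, E) M)) (𝓝 x)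
      (𝓝 ⟨x, X⟩) := by
  have h := (hasMFDerivAt_extend (E := E) (F := E) (V := TangentSpace 𝓘(ℝ, E)) X).continuousAt
  simpa [ContinuousAt] using h

namespace Expansion

variable {s : ∀ v : TangentBundle 𝓘(ℝ, E) M, TFib F V v} {x : M} {X : TangentSpace 𝓘(ℝ, E) x}
  (a : Expansion s ⟨x, X⟩)

theorem mdifferentiableAt_f (i : Fin a.n) :
    MDifferentiableAt (𝓘(ℝ, E).prod 𝓘(ℝ, E)) 𝓘(ℝ, ℝ) (a.f i) ⟨x, X⟩ :=
  (a.smooth_f i).mdifferentiableAt (by simp)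

theorem mdifferentiableAt_g (i : Fin a.n) :
    MDifferentiableAt (𝓘(ℝ, E).prod 𝓘(ℝ, E)) 𝓘(ℝ, ℝ) (a.g i) ⟨x, X⟩ :=
  (a.smooth_g i).mdifferentiableAt (by simp)

/-- The coefficients of the tangent lifts, restricted to the vector field with constant
coordinates through `X`. -/
def base (i : Fin a.n) (y : M) : ℝ := a.f i ⟨y, FiberBundle.extend E X y⟩

theorem base_self (i : Fin a.n) : a.base i x = a.f i ⟨x, X⟩ := by
  rw [base, FiberBundle.extend_apply_self]

theorem mdifferentiableAt_base (i : Fin a.n) :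
    MDifferentiableAt 𝓘(ℝ, E) 𝓘(ℝ, ℝ) (a.base i) x := by
  refine MDifferentiableAt.comp (x := x) (g := a.f i)
    (f := fun y => (⟨y, FiberBundle.extend E X y⟩ : TangentBundle 𝓘(ℝ, E) M)) ?_
    (hasMFDerivAt_extend (E := E) (F := E) (V := TangentSpace 𝓘(ℝ, E)) X).mdifferentiableAt
  simpa using a.mdifferentiableAt_f i

theorem fst_eq : ∀ᶠ v' in 𝓝 (⟨x, X⟩ : TangentBundle 𝓘(ℝ, E) M),
    (s v').1 = ∑ i, a.f i v' • a.σ i v'.proj := by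
  filter_upwards [a.eq] with v' hv'
  rw [hv']
  simp [Prod.fst_sum, liftT_eq, liftC_eq]

theorem snd_eq : ∀ᶠ v' in 𝓝 (⟨x, X⟩ : TangentBundle 𝓘(ℝ, E) M),
    (s v').2 = ∑ i, (a.f i v' • sectionDeriv (E := E) (F := F) (a.σ i) v'.proj v'.2 +
      a.g i v' • fib F v'.proj (a.σ i v'.proj)) := by
  filter_upwards [a.eq] with v' hv'
  rw [hv']
  simp [Prod.snd_sum, liftT_eq, liftC_eq]

variable {σ : Cₛ^∞⟮𝓘(ℝ, E); F, V⟯}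

/-- The projection of `s` depends only on the base point, so its expansion can be evaluated along a
vector field through `X`. This provides the expansion of `σ` for the Leibniz rules of `𝔼`. -/
theorem section_eq (hσ : ProjectsTo s σ) :
    ∀ᶠ y in 𝓝 x, σ y = ∑ i, a.base i y • a.σ i y := by
  filter_upwards [(tendsto_extend X).eventually a.fst_eq] with y hy
  rw [hσ] at hy
  exact hy

theorem sum_dT_vertical (hσ : ProjectsTo s σ) (Z : TangentSpace 𝓘(ℝ, E) x) :
    ∑ i, dT (a.f i) ⟨x, X⟩ (((0 : E), show E from Z) : E × E) • a.σ i x = 0 := by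
  have h1 : HasDerivAt (fun r : ℝ => ∑ i, a.f i ⟨x, X + r • Z⟩ • fib F x (a.σ i x))
      (∑ i, dT (a.f i) ⟨x, X⟩ (((0 : E), show E from Z) : E × E) • fib F x (a.σ i x)) 0 :=
    HasDerivAt.fun_sum fun i _ => (hasDerivAt_line (a.mdifferentiableAt_f i) Z).smul_const _
  -- Along the fibre of `TM` the sum is the constant `σ x`, so its derivative vanishes.
  have h2 : (fun r : ℝ => ∑ i, a.f i ⟨x, X + r • Z⟩ • fib F x (a.σ i x)) =ᶠ[𝓝 0]
      fun _ => fib F x (σ x) := by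
    filter_upwards [(tendsto_line X Z).eventually a.fst_eq] with r hr
    rw [hσ] at hr
    simp only at hr
    rw [hr]
    simp
  have h3 := (h1.congr_of_eventuallyEq h2.symm).unique (hasDerivAt_const (0 : ℝ) _)
  apply (fib F x).injective
  rw [map_zero, ← h3]
  simp

theorem sum_dT (hσ : ProjectsTo s σ) (Y Z : TangentSpace 𝓘(ℝ, E) x) :
    ∑ i, dT (a.f i) ⟨x, X⟩ ((show E from Y, show E from Z) : E × E) • a.σ i x =
      ∑ i, mvfderiv 𝓘(ℝ, E) (a.base i) x Y • a.σ i x := by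
  have h : ∀ i, dT (a.f i) ⟨x, X⟩ ((show E from Y, show E from Z) : E × E) =
      mvfderiv 𝓘(ℝ, E) (a.base i) x Y +
        dT (a.f i) ⟨x, X⟩ (((0 : E), show E from Z) : E × E) := fun i => by
    rw [← (hasDerivAt_line (a.mdifferentiableAt_f i) Z).deriv]
    exact dT_eq (a.f i) ⟨x, X⟩ (a.mdifferentiableAt_f i) Y Z
  simp only [h, add_smul, Finset.sum_add_distrib, a.sum_dT_vertical hσ Z, add_zero]

theorem sectionDeriv_eq (hσ : ProjectsTo s σ) (Z : TangentSpace 𝓘(ℝ, E) x) :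
    sectionDeriv (E := E) (F := F) σ x Z =
      ∑ i, (a.f i ⟨x, X⟩ • sectionDeriv (E := E) (F := F) (a.σ i) x Z +
        mvfderiv 𝓘(ℝ, E) (a.base i) x Z • fib F x (a.σ i x)) := by
  refine (mvfderiv_of_eventually_eq_sum_smul a.mdifferentiableAt_base
    (g := fun i y => (trivializationAt F V x ⟨y, a.σ i y⟩).2)
    (fun i => ((mdifferentiableAt_totalSpace _ _).1 (mdifferentiableAt_coe (a.σ i) x)).2)
    ?_ Z).trans ?_
  · filter_upwards [a.section_eq hσ, (trivializationAt F V x).open_baseSet.mem_nhds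
      (mem_baseSet_trivializationAt F V x)] with y hy hy'
    have h := isLinearMap_fibreCoord (F := F) (V := V) hy'
    rw [hy]
    refine (map_sum (h.mk' _) _ _).trans (Finset.sum_congr rfl fun i _ => ?_)
    exact h.map_smul _ _
  · simp only [base_self]
    rfl

end Expansion

variable [FiniteDimensional ℝ F]
variable {C : CourantAlgebroid E F V}
  {L : Set (TangentBundle (𝓘(ℝ, E).prod 𝓘(ℝ, F)) (TotalSpace F V))}
  {W : ∀ x, Submodule ℝ (V x)}

/-- The part of the bracket that comes from the derivatives of the coefficients along the fibres
of `TM`. -/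
theorem IsVBDirac.sum_pairingT_vertical (hL : IsVBDirac C L W)
    {s t : ∀ v : TangentBundle 𝓘(ℝ, E) M, TFib F V v} (hs : IsSectionOf L s)
    {σ τ : sections E F W} (hσ : ProjectsTo s σ.1) (hτ : ProjectsTo t τ.1)
    {x : M} {X : TangentSpace 𝓘(ℝ, E) x} (a : Expansion s ⟨x, X⟩) (Z : TangentSpace 𝓘(ℝ, E) x) :
    ∑ i, (pairingT C ⟨x, X⟩ (liftT (a.σ i) ⟨x, X⟩) (t ⟨x, X⟩) *
          dT (a.f i) ⟨x, X⟩ (((0 : E), show E from Z) : E × E) +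
        pairingT C ⟨x, X⟩ (liftC (a.σ i) ⟨x, X⟩) (t ⟨x, X⟩) *
          dT (a.g i) ⟨x, X⟩ (((0 : E), show E from Z) : E × E)) =
      ∑ i, mvfderiv 𝓘(ℝ, E) (a.base i) x Z * C.pairing x (a.σ i x) (τ.1 x) -
        nabla C L W σ x Z (value τ x) := by
  set df := fun i => dT (a.f i) ⟨x, X⟩ (((0 : E), show E from Z) : E × E) with hdf
  set dg := fun i => dT (a.g i) ⟨x, X⟩ (((0 : E), show E from Z) : E × E) with hdg
  let D := fun i (Y : TangentSpace 𝓘(ℝ, E) x) => sectionDeriv (E := E) (F := F) (a.σ i) x Y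
  let c := fun i => fib F x (a.σ i x)
  let S := fun Y : TangentSpace 𝓘(ℝ, E) x => (s ⟨x, Y⟩).2
  let R : F := ∑ i, (df i • D i X + dg i • c i)
  let ℓ : F →L[ℝ] ℝ := (((C.pairing x).flip (τ.1 x)).comp
    (fib F x).symm.toLinearEquiv.toLinearMap).toContinuousLinearMap
  have hℓ : ∀ w, ℓ w = C.pairing x ((fib F x).symm w) (τ.1 x) := fun w => rfl
  have hℓc : ∀ i, ℓ (c i) = C.pairing x (a.σ i x) (τ.1 x) := fun i => by
    rw [hℓ]
    exact congrArg (fun e => C.pairing x e (τ.1 x)) ((fib F x).symm_apply_apply _)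
  have hSL : ∀ Y, toTE (⟨x, Y⟩ : TangentBundle 𝓘(ℝ, E) M) ((σ.1 x, S Y) : V x × F) ∈ L :=
    fun Y => by
      have h := hs.2 ⟨x, Y⟩
      have h2 : s ⟨x, Y⟩ = ((σ.1 x, S Y) : V x × F) := Prod.ext (hσ ⟨x, Y⟩) rfl
      rwa [h2] at h
  have h1 : ∑ i, (pairingT C ⟨x, X⟩ (liftT (a.σ i) ⟨x, X⟩) (t ⟨x, X⟩) * df i +
      pairingT C ⟨x, X⟩ (liftC (a.σ i) ⟨x, X⟩) (t ⟨x, X⟩) * dg i) = ℓ R := by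
    -- The vertical derivative of the expansion, with the lifts frozen at `X`, projects to zero in
    -- `𝔼`. It is therefore vertical, and its pairing with `t` involves only `τ x`.
    have h2 : ∑ i, (df i • liftT (a.σ i) ⟨x, X⟩ + dg i • liftC (a.σ i) ⟨x, X⟩) =
        ((0, R) : V x × F) := by
      refine Prod.ext ?_ ?_
      · rw [← a.sum_dT_vertical hσ Z]
        simp [Prod.fst_sum, liftT_eq, liftC_eq, hdf]
      · simp [Prod.snd_sum, liftT_eq, liftC_eq, R, D, c]
    have h3 := congrArg (fun p => pairingTₗ C ⟨x, X⟩ p (t ⟨x, X⟩)) h2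
    simp only [map_sum, map_add, map_smul, LinearMap.sum_apply, LinearMap.add_apply,
      LinearMap.smul_apply, smul_eq_mul, pairingTₗ_apply] at h3
    rw [pairingT_vertical, hτ ⟨x, X⟩] at h3
    rw [hℓ, ← h3]
    simp only [mul_comm]
  -- Differentiate `ℓ (S (X + r • Z))` at `r = 0` in two ways: it is affine with slope `ℓ (S Z)`,
  -- and the product rule applies to the expansion. The last sum arises because the tangent lifts
  -- themselves vary with the base vector.
  have h4 : ℓ (S Z) = ℓ R + ∑ i, a.f i ⟨x, X⟩ * ℓ (D i Z) := by
    have e1 : HasDerivAt (fun r : ℝ => ∑ i, (a.f i ⟨x, X + r • Z⟩ * (ℓ (D i X) + r * ℓ (D i Z)) +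
        a.g i ⟨x, X + r • Z⟩ * ℓ (c i)))
        (∑ i, (df i * ℓ (D i X) + a.f i ⟨x, X⟩ * ℓ (D i Z) + dg i * ℓ (c i))) 0 := by
      refine HasDerivAt.fun_sum fun i _ => ?_
      have k1 := hasDerivAt_line (a.mdifferentiableAt_f i) Z
      have k2 := hasDerivAt_line (a.mdifferentiableAt_g i) Z
      have k3 := ((hasDerivAt_id (0 : ℝ)).mul_const (ℓ (D i Z))).const_add (ℓ (D i X))
      refine ((k1.mul k3).add (k2.mul_const (ℓ (c i)))).congr_deriv ?_
      simp [hdf, hdg]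
    have e2 : (fun r : ℝ => ∑ i, (a.f i ⟨x, X + r • Z⟩ * (ℓ (D i X) + r * ℓ (D i Z)) +
        a.g i ⟨x, X + r • Z⟩ * ℓ (c i))) =ᶠ[𝓝 0] fun r => ℓ (S X) + r * ℓ (S Z) := by
      filter_upwards [(tendsto_line X Z).eventually a.snd_eq] with r hr
      rw [hℓ, hℓ, ← hL.pairing_affine (τ.2 x) hSL X Z r, ← hℓ]
      have hr' : S (X + r • Z) = _ := hr
      rw [hr', map_sum]
      refine Finset.sum_congr rfl fun i _ => ?_
      rw [map_add, map_smul, map_smul, map_add, map_smul, map_add, map_smul]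
      rfl
    have e3 : HasDerivAt (fun r : ℝ => ℓ (S X) + r * ℓ (S Z)) (ℓ (S Z)) 0 := by
      simpa using ((hasDerivAt_id (0 : ℝ)).mul_const (ℓ (S Z))).const_add (ℓ (S X))
    rw [e3.unique (e1.congr_of_eventuallyEq e2.symm)]
    simp only [R, map_sum, map_add, map_smul, smul_eq_mul, ← Finset.sum_add_distrib]
    exact Finset.sum_congr rfl fun i _ => by ring
  have h5 : nabla C L W σ x Z (value τ x) =
      ℓ (sectionDeriv (E := E) (F := F) σ.1 x Z) - ℓ (S Z) := by
    rw [hL.nabla_eq σ (hSL Z), ← map_sub]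
    rfl
  rw [h1, h5, h4, a.sectionDeriv_eq hσ Z]
  simp only [map_sum, map_add, map_smul, smul_eq_mul, Finset.sum_add_distrib]
  have h6 : ∀ i, ℓ (fib F x (a.σ i x)) = C.pairing x (a.σ i x) (τ.1 x) := hℓc
  simp only [h6]
  change _ = _ - (∑ i, a.f i ⟨x, X⟩ * ℓ (D i Z) + _ - _)
  ring

end SideBracket

/-! ### The projection to `𝔼` of the bracket of two sections of `L`. -/

section BracketFormula

variable [FiniteDimensional ℝ E] [T2Space M] [FiniteDimensional ℝ F]
variable {C : CourantAlgebroid E F V}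
  {L : Set (TangentBundle (𝓘(ℝ, E).prod 𝓘(ℝ, F)) (TotalSpace F V))}
  {W : ∀ x, Submodule ℝ (V x)}
  {s t : ∀ v : TangentBundle 𝓘(ℝ, E) M, TFib F V v}

theorem leibnizBracket_fst_eq (C : CourantAlgebroid E F V) (v : TangentBundle 𝓘(ℝ, E) M)
    (a : Expansion s v) (b : Expansion t v) :
    (leibnizBracket C s t v a b).1 =
      ∑ i, ∑ j, (a.f i v * b.f j v) • C.bracket (a.σ i) (b.σ j) v.proj +
        ∑ j, dT (b.f j) v (anchorT C v (s v)) • b.σ j v.proj -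
        ∑ i, dT (a.f i) v (anchorT C v (t v)) • a.σ i v.proj +
        ∑ i, (pairingT C v (liftT (a.σ i) v) (t v) • (coanchorT C v (dT (a.f i) v)).1 +
          pairingT C v (liftC (a.σ i) v) (t v) • (coanchorT C v (dT (a.g i) v)).1) := by
  simp only [leibnizBracket, Prod.fst_add, Prod.fst_sub, Prod.fst_sum, Prod.smul_fst]
  simp only [liftT_eq, liftC_eq, smul_zero, add_zero]

/-- The anchor of `p` covers `a(p.1)`, and its vertical part does not contribute by `sum_dT`. -/
theorem Expansion.sum_dT_anchorT {x : M} {X : TangentSpace 𝓘(ℝ, E) x}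
    (a : Expansion s ⟨x, X⟩) {σ : Cₛ^∞⟮𝓘(ℝ, E); F, V⟯} (hσ : ProjectsTo s σ)
    (C : CourantAlgebroid E F V) (p : TFib F V (⟨x, X⟩ : TangentBundle 𝓘(ℝ, E) M)) :
    ∑ i, dT (a.f i) ⟨x, X⟩ (anchorT C ⟨x, X⟩ p) • a.σ i x =
      ∑ i, mvfderiv 𝓘(ℝ, E) (a.base i) x (C.anchor x p.1) • a.σ i x := by
  have h := anchorT_eq C ⟨x, X⟩ p
  rw [← a.sum_dT hσ (C.anchor x p.1)]
  exact Finset.sum_congr rfl fun i _ => congrArg (fun z => dT (a.f i) ⟨x, X⟩ z • a.σ i x) h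

theorem IsVBDirac.leibnizBracket_fst (hL : IsVBDirac C L W) (hs : IsSectionOf L s)
    {σ τ : sections E F W} (hσ : ProjectsTo s σ.1) (hτ : ProjectsTo t τ.1)
    {x : M} {X : TangentSpace 𝓘(ℝ, E) x} (a : Expansion s ⟨x, X⟩) (b : Expansion t ⟨x, X⟩) :
    (leibnizBracket C s t ⟨x, X⟩ a b).1 =
      C.bracket σ.1 τ.1 x - C.coanchor x (fun X => nabla C L W σ x X (value τ x)) := by
  rw [← sub_eq_zero]
  refine C.pairing_nondeg x _ fun u => ?_
  -- The vertical direction `Z = a(u)` comes from `pairing_coanchorT_fst`.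
  have h4 := hL.sum_pairingT_vertical hs hσ hτ a (C.anchor x u)
  have hc : ∀ f : TangentBundle 𝓘(ℝ, E) M → ℝ,
      C.pairing x (coanchorT C ⟨x, X⟩ (dT f ⟨x, X⟩)).1 u =
        dT f ⟨x, X⟩ ((0, show E from C.anchor x u) : E × E) :=
    fun f => pairing_coanchorT_fst C ⟨x, X⟩ f u
  rw [leibnizBracket_fst_eq]
  simp only [a.sum_dT_anchorT hσ, b.sum_dT_anchorT hτ, hσ ⟨x, X⟩, hτ ⟨x, X⟩]
  rw [map_sub, LinearMap.sub_apply, map_sub, LinearMap.sub_apply,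
    coanchor_spec C x _ (hL.isLinearMap_nabla σ x (value τ x)),
    pairing_bracket_sum_sum C a.mdifferentiableAt_base (a.section_eq hσ)
      b.mdifferentiableAt_base (b.section_eq hτ) u]
  simp only [map_add, map_sub, map_sum, map_smul, LinearMap.add_apply, LinearMap.sub_apply,
    LinearMap.sum_apply, LinearMap.smul_apply, smul_eq_mul, hc, Expansion.base_self]
  rw [h4]
  ring

/-- `bracketT` selects the value for some pair of expansions. The formula for the projection holds
for every pair, so it suffices that one exists. -/
theorem IsVBDirac.bracketT_fst (hL : IsVBDirac C L W) (hs : IsSectionOf L s)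
    (ht : IsSectionOf L t) {σ τ : sections E F W} (hσ : ProjectsTo s σ.1) (hτ : ProjectsTo t τ.1)
    (v : TangentBundle 𝓘(ℝ, E) M) :
    (bracketT C s t v).1 = C.bracket σ.1 τ.1 v.proj -
      C.coanchor v.proj (fun X => nabla C L W σ v.proj X (value τ v.proj)) := by
  obtain ⟨a⟩ := exists_expansion hs.1 v
  obtain ⟨b⟩ := exists_expansion ht.1 v
  have h : ∃ p, ∃ (a : Expansion s v) (b : Expansion t v), p = leibnizBracket C s t v a b :=
    ⟨_, a, b, rfl⟩
  obtain ⟨a', b', h'⟩ := Classical.epsilon_spec h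
  rw [bracketT, h']
  exact hL.leibnizBracket_fst hs hσ hτ a' b'

end BracketFormula

/-! ### Smooth combinations of vector fields along a map. -/

section LinearCombinations

variable {EB : Type*} [NormedAddCommGroup EB] [NormedSpace ℝ EB] {HB : Type*} [TopologicalSpace HB]
  {IB : ModelWithCorners ℝ EB HB} {B : Type*} [TopologicalSpace B] [ChartedSpace HB B]
  {F₁ : Type*} [NormedAddCommGroup F₁] [NormedSpace ℝ F₁]
  {V₁ : B → Type*} [∀ x, AddCommGroup (V₁ x)] [∀ x, Module ℝ (V₁ x)] [∀ x, TopologicalSpace (V₁ x)]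
  [TopologicalSpace (TotalSpace F₁ V₁)] [FiberBundle F₁ V₁] [VectorBundle ℝ F₁ V₁]
  {EN : Type*} [NormedAddCommGroup EN] [NormedSpace ℝ EN] {HN : Type*} [TopologicalSpace HN]
  {IN : ModelWithCorners ℝ EN HN} {N : Type*} [TopologicalSpace N] [ChartedSpace HN N]

/-- Linear combinations, with smooth coefficients, of smooth vector fields along a map `γ`. -/
theorem contMDiffAt_sum_smul_along {ι : Type*} {k : Finset ι} {γ : N → B} {n₀ : N}
    {c : ι → N → ℝ} {s : ι → ∀ n, V₁ (γ n)} (hγ : ContMDiffAt IN IB ∞ γ n₀)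
    (hc : ∀ i ∈ k, ContMDiffAt IN 𝓘(ℝ, ℝ) ∞ (c i) n₀)
    (hs : ∀ i ∈ k, ContMDiffAt IN (IB.prod 𝓘(ℝ, F₁)) ∞
      (fun n => (⟨γ n, s i n⟩ : TotalSpace F₁ V₁)) n₀) :
    ContMDiffAt IN (IB.prod 𝓘(ℝ, F₁)) ∞
      (fun n => (⟨γ n, ∑ i ∈ k, c i n • s i n⟩ : TotalSpace F₁ V₁)) n₀ := by
  rw [contMDiffAt_totalSpace]
  refine ⟨hγ, ?_⟩
  have h1 : ContMDiffAt IN 𝓘(ℝ, F₁) ∞ (fun n => ∑ i ∈ k,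
      c i n • (trivializationAt F₁ V₁ (γ n₀) ⟨γ n, s i n⟩).2) n₀ :=
    ContMDiffAt.sum fun i hi => (hc i hi).smul (contMDiffAt_totalSpace.1 (hs i hi)).2
  refine h1.congr_of_eventuallyEq ?_
  filter_upwards [hγ.continuousAt.preimage_mem_nhds
    ((trivializationAt F₁ V₁ (γ n₀)).open_baseSet.mem_nhds
      (mem_baseSet_trivializationAt F₁ V₁ _))] with n hn
  have h := (trivializationAt F₁ V₁ (γ n₀)).linear ℝ hn
  refine (map_sum (h.mk' _) _ _).trans (Finset.sum_congr rfl fun i _ => ?_)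
  exact h.map_smul _ _

end LinearCombinations

/-! ### Smooth coefficients with respect to a spanning family of vector fields. -/

section FrameCoefficients

variable [FiniteDimensional ℝ E] {n : ℕ} {X : Fin n → ∀ y : M, TangentSpace 𝓘(ℝ, E) y} {U : Set M}

/-- A tangent vector is a combination of vector fields that span the tangent spaces, with
coefficients that depend smoothly on the vector. -/
theorem exists_smooth_coefficients (hU : IsOpen U) {x₀ : M} (hx₀ : x₀ ∈ U)
    (hX : ∀ i, ∀ y ∈ U, ContMDiffAt 𝓘(ℝ, E) (𝓘(ℝ, E).prod 𝓘(ℝ, E)) ∞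
      (fun y => (⟨y, X i y⟩ : TangentBundle 𝓘(ℝ, E) M)) y)
    (hspan : ∀ Z : TangentSpace 𝓘(ℝ, E) x₀, ∃ c : Fin n → ℝ, ∑ i, c i • X i x₀ = Z) :
    ∃ U' ⊆ U, IsOpen U' ∧ x₀ ∈ U' ∧ ∃ c : Fin n → TangentBundle 𝓘(ℝ, E) M → ℝ,
      ∀ v : TangentBundle 𝓘(ℝ, E) M, v.proj ∈ U' →
        (∀ i, ContMDiffAt (𝓘(ℝ, E).prod 𝓘(ℝ, E)) 𝓘(ℝ, ℝ) ∞ (c i) v) ∧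
        ∑ i, c i v • X i v.proj = v.2 := by
  let T := trivializationAt E (TangentSpace 𝓘(ℝ, E) : M → Type _) x₀
  let A : Fin n → M → E := fun i y => fibreCoord E x₀ ⟨y, X i y⟩
  have hx₀T : x₀ ∈ T.baseSet := mem_baseSet_trivializationAt E (TangentSpace 𝓘(ℝ, E)) x₀
  have hA : ∀ i, ∀ y ∈ U ∩ T.baseSet, ContMDiffAt 𝓘(ℝ, E) 𝓘(ℝ, E) ∞ (A i) y := fun i y hy =>
    ContMDiffAt.comp (g := fibreCoord E (V := TangentSpace 𝓘(ℝ, E)) x₀) y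
      (contMDiffAt_fibreCoord (E := E) (F := E) (V := TangentSpace 𝓘(ℝ, E)) hy.2 (X i y))
      (hX i y hy.1)
  let P : (Fin n → ℝ) →ₗ[ℝ] E := ∑ i, (LinearMap.proj i).smulRight (A i x₀)
  have hP : ∀ c, P c = ∑ i, c i • A i x₀ := fun c => by simp [P]
  have hlin : ∀ {y}, y ∈ T.baseSet → ∀ c : Fin n → ℝ,
      fibreCoord E x₀ ⟨y, ∑ i, c i • X i y⟩ = ∑ i, c i • A i y := fun hy c => by
    have h := isLinearMap_fibreCoord (F := E) (V := TangentSpace 𝓘(ℝ, E)) hy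
    exact (map_sum (h.mk' _) _ _).trans (Finset.sum_congr rfl fun i _ => h.map_smul _ _)
  -- The `X i` need not be independent, so the coefficients are chosen at `x₀` by a linear right
  -- inverse `R`. At nearby points they are corrected by the inverse of `Q y`, which is the identity
  -- at `x₀` and hence invertible close to it.
  obtain ⟨R, hR⟩ := P.exists_rightInverse_of_surjective (LinearMap.range_eq_top.2 fun z => by
    obtain ⟨c, hc⟩ := hspan ((fib E x₀).symm z)
    refine ⟨c, ?_⟩
    rw [hP, ← hlin hx₀T, hc]
    exact (fib E (V := TangentSpace 𝓘(ℝ, E)) x₀).apply_symm_apply z)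
  let r : Fin n → E →L[ℝ] ℝ := fun i => ((LinearMap.proj i).comp R).toContinuousLinearMap
  let Q : M → E →L[ℝ] E := fun y => ∑ i, (r i).smulRight (A i y)
  have hQ : ∀ y z, Q y z = ∑ i, r i z • A i y := fun y z => by
    simp [Q]
  have hQs : ∀ y ∈ U ∩ T.baseSet, ContMDiffAt 𝓘(ℝ, E) 𝓘(ℝ, E →L[ℝ] E) ∞ Q y := fun y hy =>
    ContMDiffAt.sum fun i _ =>
      (ContinuousLinearMap.smulRightL ℝ E E (r i)).contMDiff.contMDiffAt.comp y (hA i y hy)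
  have hQ₀ : Q x₀ = (ContinuousLinearEquiv.refl ℝ E : E →L[ℝ] E) := by
    ext z
    rw [hQ]
    exact (hP (R z)).symm.trans (LinearMap.congr_fun hR z)
  have hev : ∀ᶠ y in 𝓝 x₀, Q y ∈ range ((↑) : (E ≃L[ℝ] E) → E →L[ℝ] E) :=
    (hQs x₀ ⟨hx₀, hx₀T⟩).continuousAt.preimage_mem_nhds
      (by rw [hQ₀]; exact ContinuousLinearEquiv.nhds _)
  obtain ⟨U', hU', hU'o, hxU'⟩ := mem_nhds_iff.1
    (hev.and ((hU.inter T.open_baseSet).mem_nhds ⟨hx₀, hx₀T⟩))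
  refine ⟨U', fun y hy => (hU' hy).2.1, hU'o, hxU',
    fun i v => r i ((Q v.proj).inverse (fibreCoord E x₀ v)), fun v hv => ?_⟩
  obtain ⟨⟨e, he⟩, hyU, hyT⟩ := hU' hv
  refine ⟨fun i => ?_, ?_⟩
  · have h1 : ContMDiffAt (𝓘(ℝ, E).prod 𝓘(ℝ, E)) 𝓘(ℝ, E →L[ℝ] E) ∞
        (fun v : TangentBundle 𝓘(ℝ, E) M => Q v.proj) v :=
      (hQs _ ⟨hyU, hyT⟩).comp v (contMDiff_proj _).contMDiffAt
    have h2 : ContMDiffAt 𝓘(ℝ, E →L[ℝ] E) 𝓘(ℝ, E →L[ℝ] E) ∞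
        (ContinuousLinearMap.inverse : (E →L[ℝ] E) → E →L[ℝ] E) (Q v.proj) := by
      rw [← he]
      exact (contDiffAt_map_inverse e).contMDiffAt
    exact (r i).contMDiff.contMDiffAt.comp v ((h2.comp v h1).clm_apply
      (contMDiffAt_fibreCoord (E := E) (F := E) (V := TangentSpace 𝓘(ℝ, E)) hyT v.2))
  · apply fibreCoord_injective (F := E) (V := TangentSpace 𝓘(ℝ, E)) hyT
    simp only
    rw [hlin hyT, ← hQ, ← he, ContinuousLinearMap.inverse_equiv]
    exact e.apply_symm_apply _

end FrameCoefficients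

/-! ### Lifting sections of `W` to sections of `L → TM`. -/

section Lifting

variable [FiniteDimensional ℝ E] [FiniteDimensional ℝ F]
variable {L : Set (TangentBundle (𝓘(ℝ, E).prod 𝓘(ℝ, F)) (TotalSpace F V))}
  {W : ∀ x, Submodule ℝ (V x)}

namespace IsDoubleVectorSubbundle

theorem exists_local_lift (hL : IsDoubleVectorSubbundle (E := E) L W) (σ : sections E F W)
    (x₀ : M) :
    ∃ U : Set M, IsOpen U ∧ x₀ ∈ U ∧ ∃ S : TangentBundle 𝓘(ℝ, E) M → F,
      ∀ v : TangentBundle 𝓘(ℝ, E) M, v.proj ∈ U →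
        ContMDiffAt (𝓘(ℝ, E).prod 𝓘(ℝ, E)) ((𝓘(ℝ, E).prod 𝓘(ℝ, F)).prod 𝓘(ℝ, E × F)) ∞
          (fun v => toTE v ((σ.1 v.proj, S v) : TFib F V v)) v ∧
        toTE v ((σ.1 v.proj, S v) : TFib F V v) ∈ L := by
  have hsec : ∀ (x : M) (X : TangentSpace 𝓘(ℝ, E) x), ∃ w : F,
      toTE (⟨x, X⟩ : TangentBundle 𝓘(ℝ, E) M) ((σ.1 x, w) : V x × F) ∈ L :=
    fun x X => hL.exists_mem X (σ.2 x)
  obtain ⟨D, hD, hfr⟩ := hL.over_side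
  let γ : M → TotalSpace F V := fun y => ⟨y, σ.1 y⟩
  have hγ : ContMDiff 𝓘(ℝ, E) (𝓘(ℝ, E).prod 𝓘(ℝ, F)) ∞ γ := σ.1.contMDiff
  obtain ⟨U, hU, hxU, n, ξ, hξ, hspan⟩ := hfr (γ x₀) (σ.2 x₀)
  have hU₁ : IsOpen (γ ⁻¹' U) := hU.preimage hγ.continuous
  have hξγ : ∀ i, ∀ y ∈ γ ⁻¹' U, ContMDiffAt 𝓘(ℝ, E)
      ((𝓘(ℝ, E).prod 𝓘(ℝ, F)).prod 𝓘(ℝ, E × F)) ∞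
      (fun y => (⟨γ y, ξ i (γ y)⟩ :
        TangentBundle (𝓘(ℝ, E).prod 𝓘(ℝ, F)) (TotalSpace F V))) y := fun i y hy =>
    ContMDiffAt.comp (g := fun e => (⟨e, ξ i e⟩ :
      TangentBundle (𝓘(ℝ, E).prod 𝓘(ℝ, F)) (TotalSpace F V))) y
      ((hξ i).contMDiffAt (hU.mem_nhds hy)) hγ.contMDiffAt
  let X : Fin n → ∀ y : M, TangentSpace 𝓘(ℝ, E) y := fun i y => (show E × F from ξ i (γ y)).1
  have hX : ∀ i, ∀ y ∈ γ ⁻¹' U, ContMDiffAt 𝓘(ℝ, E) (𝓘(ℝ, E).prod 𝓘(ℝ, E)) ∞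
      (fun y => (⟨y, X i y⟩ : TangentBundle 𝓘(ℝ, E) M)) y := fun i y hy => by
    have hπ : ContMDiff (𝓘(ℝ, E).prod 𝓘(ℝ, F)) 𝓘(ℝ, E) ∞ (TotalSpace.proj : TotalSpace F V → M) :=
      contMDiff_proj V
    have h := (hπ.contMDiff_tangentMap (m := ∞) le_rfl).contMDiffAt.comp y (hξγ i y hy)
    refine h.congr_of_eventuallyEq (Eventually.of_forall fun z => ?_)
    exact (tangentMap_proj_toTE (⟨z, X i z⟩ : TangentBundle 𝓘(ℝ, E) M)
      ((σ.1 z, (show E × F from ξ i (γ z)).2) : V z × F)).symm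
  -- By `exists_mem`, the fibre of `L` at `σ x₀` maps onto `T_{x₀} M`, so the projections `X i` of
  -- the frame `ξ i` span it.
  obtain ⟨U', hU', hU'o, hxU', c, hc⟩ := exists_smooth_coefficients hU₁ hxU hX fun Z => by
    obtain ⟨w, hw⟩ := hsec x₀ Z
    have hw' := ((hD _).1 hw).2
    rw [toTE] at hw'
    simp only at hw'
    rw [← (hspan (γ x₀) ⟨hxU, σ.2 x₀⟩).2] at hw'
    obtain ⟨a, ha⟩ := (Submodule.mem_span_range_iff_exists_fun ℝ).1 hw'
    refine ⟨a, ?_⟩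
    have h := congrArg (fun p : E × F => p.1) ha
    refine Eq.trans ?_ h
    exact (Prod.fst_sum (s := Finset.univ)
      (f := fun i => a i • (show E × F from ξ i (γ x₀)))).symm
  refine ⟨U', hU'o, hxU', fun v => ∑ i, c i v • (show E × F from ξ i (γ v.proj)).2, fun v hv => ?_⟩
  have key : ∀ v : TangentBundle 𝓘(ℝ, E) M, v.proj ∈ U' →
      toTE v ((σ.1 v.proj, ∑ i, c i v • (show E × F from ξ i (γ v.proj)).2) : TFib F V v) =
        ⟨γ v.proj, ∑ i, c i v • ξ i (γ v.proj)⟩ := fun v hv => by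
    have h : ((show E from v.2, ∑ i, c i v • (show E × F from ξ i (γ v.proj)).2) : E × F) =
        ∑ i, c i v • (show E × F from ξ i (γ v.proj)) := by
      refine Prod.ext ?_ ?_
      · rw [Prod.fst_sum]
        exact (hc v hv).2.symm
      · rw [Prod.snd_sum]
        rfl
    exact congrArg (fun z => (⟨γ v.proj, z⟩ :
      TangentBundle (𝓘(ℝ, E).prod 𝓘(ℝ, F)) (TotalSpace F V))) h
  constructor
  · have h := contMDiffAt_sum_smul_along (k := Finset.univ) (n₀ := v)
      (IB := 𝓘(ℝ, E).prod 𝓘(ℝ, F)) (IN := 𝓘(ℝ, E).prod 𝓘(ℝ, E))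
      (V₁ := (TangentSpace (𝓘(ℝ, E).prod 𝓘(ℝ, F)) : TotalSpace F V → Type _))
      (γ := fun v : TangentBundle 𝓘(ℝ, E) M => γ v.proj) (c := c)
      (s := fun i v => ξ i (γ v.proj))
      (hγ.contMDiffAt.comp v (contMDiff_proj _).contMDiffAt) (fun i _ => (hc v hv).1 i)
      (fun i _ => (hξγ i v.proj (hU' hv)).comp v (contMDiff_proj _).contMDiffAt)
    refine h.congr_of_eventuallyEq ?_
    filter_upwards [(FiberBundle.continuous_proj E (TangentSpace 𝓘(ℝ, E))).continuousAt
      |>.preimage_mem_nhds (hU'o.mem_nhds hv)] with v' hv' using key v' hv'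
  · rw [key v hv, hD]
    refine ⟨σ.2 v.proj, ?_⟩
    rw [← (hspan (γ v.proj) ⟨hU' hv, σ.2 v.proj⟩).2]
    change ∑ i, c i v • ξ i (γ v.proj) ∈ _
    refine Submodule.sum_mem _ fun i _ => Submodule.smul_mem _ _ ?_
    exact Submodule.subset_span (mem_range_self i)

/-- Every section of `W` is the projection of a section of `L → TM`. -/
theorem exists_lift [T2Space M] [SigmaCompactSpace M]
    (hL : IsDoubleVectorSubbundle (E := E) L W) (σ : sections E F W) :
    ∃ s : ∀ v : TangentBundle 𝓘(ℝ, E) M, TFib F V v, IsSectionOf L s ∧ ProjectsTo s σ.1 := by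
  choose U hU hxU S hS using hL.exists_local_lift σ
  obtain ⟨ρ, hρ⟩ := SmoothPartitionOfUnity.exists_isSubordinate 𝓘(ℝ, E) isClosed_univ U hU
    (fun x _ => mem_iUnion.2 ⟨x, hxU x⟩)
  obtain ⟨D, hD, -⟩ := hL.over_side
  let γ : M → TotalSpace F V := fun y => ⟨y, σ.1 y⟩
  have hγ : ContMDiff 𝓘(ℝ, E) (𝓘(ℝ, E).prod 𝓘(ℝ, F)) ∞ γ := σ.1.contMDiff
  let η : M → ∀ v : TangentBundle 𝓘(ℝ, E) M,
    TangentSpace (𝓘(ℝ, E).prod 𝓘(ℝ, F)) (γ v.proj) := fun k v => ((show E from v.2, S k v) : E × F)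
  let s : ∀ v : TangentBundle 𝓘(ℝ, E) M, TFib F V v := fun v =>
    (σ.1 v.proj, ∑ᶠ k, ρ k v.proj • S k v)
  -- The local lifts over `v` share the base point `σ x` in `W` and the velocity `v`. A combination
  -- in `T_{σ x} 𝔼` with weights of sum `1` therefore still lies over `v`, and it remains in `L` by
  -- linearity over `W`.
  have key : ∀ (v : TangentBundle 𝓘(ℝ, E) M) (t : Finset M), ρ.finsupport v.proj ⊆ t →
      toTE v (s v) = ⟨γ v.proj, ∑ k ∈ t, ρ k v.proj • η k v⟩ := fun v t ht => by
    have h : ((show E from v.2, ∑ᶠ k, ρ k v.proj • S k v) : E × F) =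
        ∑ k ∈ t, ρ k v.proj • ((show E from v.2, S k v) : E × F) := by
      refine Prod.ext ?_ ?_
      · rw [Prod.fst_sum]
        simp only [Prod.smul_fst]
        refine Eq.trans ?_ (Finset.sum_smul (x := (show E from v.2)))
        rw [ρ.sum_finsupport' v.proj (mem_univ _) ht, one_smul]
      · rw [Prod.snd_sum]
        refine finsum_eq_sum_of_support_subset _ fun k hk => ht ?_
        rw [ρ.mem_finsupport]
        exact fun h0 => hk (by simp only [h0, zero_smul])
    exact congrArg (fun z => (⟨γ v.proj, z⟩ :
      TangentBundle (𝓘(ℝ, E).prod 𝓘(ℝ, F)) (TotalSpace F V))) h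
  refine ⟨s, ⟨fun v => ?_, fun v => ?_⟩, fun v => rfl⟩
  · have h := contMDiffAt_sum_smul_along (k := ρ.fintsupport v.proj) (n₀ := v)
      (IB := 𝓘(ℝ, E).prod 𝓘(ℝ, F)) (IN := 𝓘(ℝ, E).prod 𝓘(ℝ, E))
      (V₁ := (TangentSpace (𝓘(ℝ, E).prod 𝓘(ℝ, F)) : TotalSpace F V → Type _))
      (γ := fun v : TangentBundle 𝓘(ℝ, E) M => γ v.proj) (c := fun k v => ρ k v.proj)
      (s := η)
      (hγ.contMDiffAt.comp v (contMDiff_proj _).contMDiffAt)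
      (fun k _ => (ρ k).contMDiff.contMDiffAt.comp v (contMDiff_proj _).contMDiffAt)
      (fun k hk => (hS k v (hρ k ((ρ.mem_fintsupport_iff _ k).1 hk))).1)
    refine h.congr_of_eventuallyEq ?_
    filter_upwards [(FiberBundle.continuous_proj E (TangentSpace 𝓘(ℝ, E))).continuousAt
      |>.eventually (ρ.eventually_finsupport_subset v.proj)] with v' hv' using key v' _ hv'
  · rw [key v _ subset_rfl, hD]
    refine ⟨σ.2 v.proj, Submodule.sum_mem _ fun k hk => Submodule.smul_mem _ _ ?_⟩
    have hk' : v.proj ∈ U k := hρ k (subset_tsupport _ ((ρ.mem_finsupport _).1 hk))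
    exact ((hD _).1 (hS k v hk').2).2

end IsDoubleVectorSubbundle

end Lifting

/-! ### Existence and uniqueness of the inherited bracket. -/

section InheritedBracket

variable [FiniteDimensional ℝ E] [T2Space M] [FiniteDimensional ℝ F]
variable {C : CourantAlgebroid E F V}
  {L : Set (TangentBundle (𝓘(ℝ, E).prod 𝓘(ℝ, F)) (TotalSpace F V))}
  {W : ∀ x, Submodule ℝ (V x)}

theorem IsSectionOf.contMDiff_fst {s : ∀ v : TangentBundle 𝓘(ℝ, E) M, TFib F V v}
    (hs : IsSectionOf L s) :
    ContMDiff 𝓘(ℝ, E) (𝓘(ℝ, E).prod 𝓘(ℝ, F)) ∞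
      (fun x => (⟨x, (s ⟨x, 0⟩).1⟩ : TotalSpace F V)) :=
  (contMDiff_proj (TangentSpace (𝓘(ℝ, E).prod 𝓘(ℝ, F)))).comp
    (hs.1.comp (contMDiff_zeroSection ℝ (TangentSpace 𝓘(ℝ, E) : M → Type _)))

theorem IsVBDirac.exists_isInheritedBracket [SigmaCompactSpace M] (hL : IsVBDirac C L W)
    (σ τ : sections E F W) :
    ∃ ρ : sections E F W, IsInheritedBracket C L σ.1 τ.1 ρ.1 ∧
      ∀ x, ρ.1 x =
        C.bracket σ.1 τ.1 x - C.coanchor x (fun X => nabla C L W σ x X (value τ x)) := by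
  obtain ⟨s, hs, hsσ⟩ := hL.toIsDoubleVectorSubbundle.exists_lift σ
  obtain ⟨t, ht, htτ⟩ := hL.toIsDoubleVectorSubbundle.exists_lift τ
  have hst := hL.involutive s t hs ht
  -- The candidate is the projection of `⟦s, t⟧` restricted to the zero section of `TM`.
  -- Involutivity of `L` makes it smooth with values in `W`, and `bracketT_fst` shows that it
  -- depends neither on the lifts nor on the vector in `T_xM`.
  refine ⟨⟨⟨fun x => (bracketT C s t ⟨x, 0⟩).1, hst.contMDiff_fst⟩,
    fun x => hL.toIsDoubleVectorSubbundle.fst_mem (hst.2 ⟨x, 0⟩)⟩,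
    ⟨⟨s, t, hs, ht, hsσ, htτ⟩, fun s' t' hs' ht' hσ' hτ' v => ?_⟩,
    fun x => hL.bracketT_fst hs ht hsσ htτ ⟨x, 0⟩⟩
  exact (hL.bracketT_fst hs' ht' hσ' hτ' v).trans (hL.bracketT_fst hs ht hsσ htτ ⟨v.proj, 0⟩).symm

theorem IsVBDirac.bracket_eq_of_isInherited [SigmaCompactSpace M] (hL : IsVBDirac C L W)
    {A : LieAlgebroid E F W} (hA : IsInherited C L W A) (σ τ : sections E F W) (x : M) :
    (A.bracket σ τ).1 x =
      C.bracket σ.1 τ.1 x - C.coanchor x (fun X => nabla C L W σ x X (value τ x)) := by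
  obtain ⟨s, hs, hsσ⟩ := hL.toIsDoubleVectorSubbundle.exists_lift σ
  obtain ⟨t, ht, htτ⟩ := hL.toIsDoubleVectorSubbundle.exists_lift τ
  exact (hA.bracket σ τ s t hs ht hsσ htτ ⟨x, 0⟩).symm.trans
    (hL.bracketT_fst hs ht hsσ htτ ⟨x, 0⟩)

end InheritedBracket

end VBDirac

end

theorem mainTheorem5
    {E : Type*} [NormedAddCommGroup E] [NormedSpace ℝ E] [FiniteDimensional ℝ E]
    {M : Type*} [TopologicalSpace M] [T2Space M] [SigmaCompactSpace M] [ChartedSpace E M]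
    [IsManifold 𝓘(ℝ, E) ∞ M]
    {F : Type*} [NormedAddCommGroup F] [NormedSpace ℝ F] [FiniteDimensional ℝ F]
    {V : M → Type*} [∀ x, AddCommGroup (V x)] [∀ x, Module ℝ (V x)]
    [∀ x, TopologicalSpace (V x)] [TopologicalSpace (TotalSpace F V)] [FiberBundle F V]
    [VectorBundle ℝ F V] [ContMDiffVectorBundle ∞ F V 𝓘(ℝ, E)]
    (C : CourantAlgebroid E F V)
    (L : Set (TangentBundle (𝓘(ℝ, E).prod 𝓘(ℝ, F)) (TotalSpace F V)))
    (W : ∀ x, Submodule ℝ (V x)) (hL : IsVBDirac C L W) :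
    (∀ σ τ : sections E F W, ∃ ρ : sections E F W, IsInheritedBracket C L σ.1 τ.1 ρ.1 ∧
      ∀ x, ρ.1 x =
        C.bracket σ.1 τ.1 x - C.coanchor x (fun X => nabla C L W σ x X (value τ x))) ∧
    ∀ A : LieAlgebroid E F W, IsInherited C L W A → ∀ (σ τ : sections E F W) (x : M),
      (A.bracket σ τ).1 x =
        C.bracket σ.1 τ.1 x - C.coanchor x (fun X => nabla C L W σ x X (value τ x)) :=
  ⟨fun σ τ => hL.exists_isInheritedBracket σ τ,
    fun _ hA σ τ x => hL.bracket_eq_of_isInherited hA σ τ x⟩
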